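/- Let $\mathrm{G}$ be a locally compact unimodular group with Haar measure $\mu$ and let $\Sigma \subset \mathrm{G}$ be open. Let $\alpha : \mathrm{G} \to \mathrm{SL}_d(\mathbf{R})$ be a continuous representation and let $\beta : \mathrm{G} \to \mathbf{R}^d$ be a continuous map satisfying the cocycle law $\alpha_g(\beta(h)) = \beta(gh) - \beta(g)$ for all $g,h \in \mathrm{G}$. Let $\dot m : \mathbf{R}^d \to \mathbf{C}$ be continuous, and put $m = \dot m \circ \beta : \mathrm{G} \to \mathbf{C}$ and $\dot m_g(\xi) = \dot m(\alpha_g(\xi))$. Let $\mathcal{R}_\Sigma = L_\infty(\mathbf{R}^d) \bar\otimes \mathcal{B}(L_2(\Sigma))$, so that $L_p(\mathcal{R}_\Sigma) = L_p(\mathbf{R}^d; S_p(L_2(\Sigma)))$ for $p < \infty$, where $S_p$ denotes the Schatten class. Consider the Schur multiplier $S_m : (a_{gh})_{g,h \in \Sigma} \mapsto (m(gh^{-1}) a_{gh})_{g,h \in \Sigma}$, defined on kernels in $S_2(L_2(\Sigma)) \cap S_p(L_2(\Sigma))$, and the twisted Fourier multiplier $\widetilde T_{\dot m} : (f_{gh})_{g,h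 \in \Sigma} \mapsto (T_{\dot m_g} f_{gh})_{g,h \in \Sigma}$ with $\widehat{T_{\dot m_g} f_{gh}}(\xi) = \dot m(\alpha_g(\xi)) \widehat{f}_{gh}(\xi)$, defined on $L_2(\mathbf{R}^d; S_2(L_2(\Sigma))) \cap L_p(\mathcal{R}_\Sigma)$. For either map $T$, acting on $L_p(\mathcal{M})$ with $\mathcal{M} = \mathcal{B}(L_2(\Sigma))$ or $\mathcal{M} = \mathcal{R}_\Sigma$, let $\|T\|_{\mathrm{cb}} \in [0,\infty]$ be the supremum over $n \ge 1$ of the norms of the amplifications $\mathrm{id} \otimes T : (x_{ij}) \mapsto (T x_{ij})$ with respect to the norm of $L_p(M_n \otimes \mathcal{M})$, on $n \times n$ matrices with entries in the given domain; it is $\infty$ if $T$ takes some element of the domain out of $S_2(L_2(\Sigma))$, respectively out of $L_2(\mathbf{R}^d; S_2(L_2(\Sigma)))$. Then, for every $1 \le p \le \infty$, $$\big\| S_m : S_p(L_2(\Sigma)) \to S_p(L_2(\Sigma)) \big\|_{\mathrm{cb}} \, \le \, \big\| \widetilde T_{\dot m} : L_p(\mathcal{R}_\Sigma) \to L_p(\mathcal{R}_\Sigma)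 \big\|_{\mathrm{cb}}.$$ -/

import Mathlib

open MeasureTheory
open scoped ENNReal FourierTransform

noncomputable section

namespace TwistedMultiplier

/-! ### Schatten norms -/

section Schatten

variable {H : Type*} [NormedAddCommGroup H] [InnerProductSpace ℂ H]

/-- The canonical trace `Tr T ∈ [0, ∞]` of a positive operator `T` on a Hilbert space: the sum
`∑ ⟨T e, e⟩` over an orthonormal basis, i.e. the supremum of these sums over all finite orthonormal
families. -/
def opTrace (T : H →L[ℂ] H) : ℝ≥0∞ :=
  ⨆ (s : Finset H) (_ : Orthonormal ℂ (Subtype.val : s → H)),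
    ∑ e ∈ s, ENNReal.ofReal (inner ℂ (T e) e).re

/-- The Schatten norm `‖A‖_{S_p(H)} = (Tr |A|^p)^{1/p} ∈ [0, ∞]` for `p < ∞`, where
`|A| = (A* A)^{1/2}`, and the operator norm for `p = ∞`.
`A ∈ S_p(H)` means that this is finite. -/
def schattenNorm [CompleteSpace H] (p : ℝ≥0∞) (A : H →L[ℂ] H) : ℝ≥0∞ :=
  if p = ∞ then ‖A‖ₑ
  else (opTrace (CFC.abs A ^ p.toReal)) ^ (1 / p.toReal)

/-- The operator on the `n`-fold Hilbert sum `ℓ₂ⁿ(H) = ℓ₂ⁿ ⊗ H` given by an `n × n` matrix of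
operators on `H`: `(A x)_i = ∑_j A_{ij} x_j`. -/
def blockOp {n : ℕ} (A : Matrix (Fin n) (Fin n) (H →L[ℂ] H)) :
    PiLp 2 (fun _ : Fin n => H) →L[ℂ] PiLp 2 (fun _ : Fin n => H) :=
  ((PiLp.continuousLinearEquiv 2 ℂ (fun _ : Fin n => H)).symm :
      (Fin n → H) →L[ℂ] PiLp 2 (fun _ : Fin n => H)) ∘L
    (ContinuousLinearMap.pi fun i => ∑ j, A i j ∘L ContinuousLinearMap.proj j) ∘L
    ((PiLp.continuousLinearEquiv 2 ℂ (fun _ : Fin n => H)) :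
      PiLp 2 (fun _ : Fin n => H) →L[ℂ] (Fin n → H))

theorem blockOp_apply {n : ℕ} (A : Matrix (Fin n) (Fin n) (H →L[ℂ] H))
    (x : PiLp 2 (fun _ : Fin n => H)) (i : Fin n) :
    blockOp A x i = ∑ j, A i j (x j) := by
  simp [blockOp]

end Schatten

/-! ### Hilbert-Schmidt operators on `L₂` as kernels -/

section Kernel

variable {X : Type*} [MeasurableSpace X]

/-- The space `S₂(L₂(ν))` of Hilbert-Schmidt operators, presented through their kernels (matrices)
`k = (k_{gh})`. A kernel is a square integrable family `g ↦ k_g = k(g, ·)` of rows in `L₂(ν)`;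
for σ-finite `ν` this space is `L₂(ν × ν)`, and the present form is correct for every `ν`. -/
abbrev HSKernel (ν : Measure X) : Type _ := Lp (Lp ℂ 2 ν) 2 ν

variable {ν : Measure X}

/-- The bilinear pairing with `η ∈ L₂(ν)`: the functional `u ↦ ∫ u(h) η(h) dν(h)` on `L₂(ν)`. -/
def pairing (η : Lp ℂ 2 ν) : Lp ℂ 2 ν →L[ℂ] ℂ := innerSL ℂ (star η)

theorem pairing_apply (η u : Lp ℂ 2 ν) : pairing η u = ∫ h, u h * η h ∂ν := by
  rw [pairing, innerSL_apply_apply, L2.inner_def]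
  refine integral_congr_ae ?_
  filter_upwards [Lp.coeFn_star η] with h hh
  simp [hh]

/-- The operator on `L₂(ν)` with kernel `k`, see `kernelOp_apply`. -/
def kernelOp (k : HSKernel ν) : Lp ℂ 2 ν →L[ℂ] Lp ℂ 2 ν :=
  LinearMap.mkContinuous
    { toFun := fun η => (pairing η).compLp k
      map_add' := fun η ζ => by
        have : pairing (η + ζ) = pairing η + pairing ζ := by
          have hs : star (η + ζ) = star η + star ζ := by
            refine Lp.ext ?_
            filter_upwards [Lp.coeFn_star (η + ζ), Lp.coeFn_add η ζ, Lp.coeFn_star η,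
              Lp.coeFn_star ζ, Lp.coeFn_add (star η) (star ζ)] with h h1 h2 h3 h4 h5
            rw [h1, Pi.star_apply, h2, h5, Pi.add_apply, Pi.add_apply, h3, h4, Pi.star_apply,
              Pi.star_apply, star_add]
          rw [pairing, hs, map_add]
          rfl
        rw [this, ContinuousLinearMap.add_compLp]
      map_smul' := fun c η => by
        have : pairing (c • η) = c • pairing η := by
          ext u
          rw [smul_apply, pairing_apply, pairing_apply, smul_eq_mul,
            ← integral_const_mul]
          refine integral_congr_ae ?_
          filter_upwards [Lp.coeFn_smul c η] with h hh
          rw [hh, Pi.smul_apply, smul_eq_mul]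
          ring
        rw [this, ContinuousLinearMap.smul_compLp]
        rfl }
    ‖k‖ (fun η => by
      have h1 : ‖pairing η‖ = ‖η‖ := by
        rw [pairing, innerSL_apply_norm, Lp.norm_def, Lp.norm_def]
        congr 1
        refine eLpNorm_congr_norm_ae ?_
        filter_upwards [Lp.coeFn_star η] with h hh
        simp [hh]
      calc ‖(pairing η).compLp k‖ ≤ ‖pairing η‖ * ‖k‖ := ContinuousLinearMap.norm_compLp_le _ _
        _ = ‖k‖ * ‖η‖ := by rw [h1, mul_comm])

/-- `(k η)(g) = ∫ k_{gh} η(h) dν(h)`. -/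
theorem kernelOp_apply (k : HSKernel ν) (η : Lp ℂ 2 ν) :
    kernelOp k η =ᵐ[ν] fun g => ∫ h, k g h * η h ∂ν := by
  have h1 : kernelOp k η = (pairing η).compLp k := rfl
  rw [h1]
  filter_upwards [ContinuousLinearMap.coeFn_compLp (pairing η) k] with g hg
  rw [hg, pairing_apply]

/-- `k' = s • k` is the Schur (entrywise) product of the kernel `k` with the symbol `s`:
`k'_{gh} = s(g,h) k_{gh}` for almost all `g, h`. -/
def IsSchurProduct (s : X → X → ℂ) (k k' : HSKernel ν) : Prop :=
  ∀ᵐ g ∂ν, ∀ᵐ h ∂ν, k' g h = s g h * k g h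

/-- The norm in `S_p(ℓ₂ⁿ ⊗ L₂(ν)) = S_pⁿ[S_p(L₂(ν))]` of an `n × n` matrix of kernels. -/
def matrixSchattenNorm (p : ℝ≥0∞) {n : ℕ} (a : Matrix (Fin n) (Fin n) (HSKernel ν)) : ℝ≥0∞ :=
  schattenNorm p (blockOp (a.map kernelOp))

end Kernel

/-! ### Completely bounded norms -/

/-- The completely bounded norm of a linear map `T` (given by its graph) on a noncommutative
`L_p`-space `L`, computed on a dense subspace `D ∩ L` of elements. Here `N n` is the `[0, ∞]`-valued
norm of `S_pⁿ[L] = L_p(M_n ⊗ M)` on the `n × n` matrices over `D`, and the elements of `S_pⁿ[L]` are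
the ones with finite norm. The cb-norm is the supremum over `n` of the norms of the amplifications
`id ⊗ T : (x_{ij}) ↦ (T x_{ij})` on `S_pⁿ[L]`, and it is `∞` if no finite `C` bounds them all
or if `T x` fails to be defined in `D` for some `x`. -/
def cbNorm {D : Type*} (T : D → D → Prop)
    (N : ∀ n : ℕ, Matrix (Fin n) (Fin n) D → ℝ≥0∞) : ℝ≥0∞ :=
  sInf {C : ℝ≥0∞ | ∀ (n : ℕ) (x : Matrix (Fin n) (Fin n) D), N n x ≠ ∞ →
    ∃ y : Matrix (Fin n) (Fin n) D, (∀ i j, T (x i j) (y i j)) ∧ N n y ≤ C * N n x}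

/-- `‖S_m : S_p(L₂(ν)) → S_p(L₂(ν))‖_cb` for the Schur multiplier
`S_m : (a_{gh}) ↦ (m(g h⁻¹) a_{gh})`, defined on `S₂(L₂(ν)) ∩ S_p(L₂(ν))`. -/
def schurCbNorm {G : Type*} [Group G] [MeasurableSpace G] (ν : Measure G) (p : ℝ≥0∞)
    (m : G → ℂ) : ℝ≥0∞ :=
  cbNorm (D := HSKernel ν) (IsSchurProduct fun g h => m (g * h⁻¹))
    (fun _ a => matrixSchattenNorm p a)

/-! ### Twisted Fourier multipliers -/

/-- The linear action of `SL_d(ℝ)` on the Euclidean space `ℝ^d`. -/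
def slAct {d : ℕ} (A : Matrix.SpecialLinearGroup (Fin d) ℝ) (ξ : EuclideanSpace ℝ (Fin d)) :
    EuclideanSpace ℝ (Fin d) :=
  WithLp.toLp 2 (A.1.mulVec ξ.ofLp)

section Twisted

variable {G : Type*} [MeasurableSpace G] (ν : Measure G) {d : ℕ}

/-- The Hilbert space `L₂(ℝ^d; S₂(L₂(ν)))` of square integrable matrix-valued functions
`f = (f_{gh})` on `ℝ^d`. -/
abbrev L2HS (d : ℕ) : Type _ := Lp (HSKernel ν) 2 (volume : Measure (EuclideanSpace ℝ (Fin d)))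

variable {ν}

/-- `f' = T̃_M f` for the twisted Fourier multiplier with matrix symbol
`(M_{gh}(ξ)) = (M_g(ξ))`: the Fourier transforms in `ℝ^d` satisfy
`f̂'_{gh}(ξ) = M_g(ξ) f̂_{gh}(ξ)` for almost all `ξ, g, h`. -/
def IsTwistedMultiplierImage (M : G → EuclideanSpace ℝ (Fin d) → ℂ) (f f' : L2HS ν d) : Prop :=
  ∀ᵐ ξ, IsSchurProduct (fun g _ => M g ξ) ((𝓕 f : L2HS ν d) ξ) ((𝓕 f' : L2HS ν d) ξ)

/-- The norm in `L_p(ℝ^d; S_p(ℓ₂ⁿ ⊗ L₂(ν))) = S_pⁿ[L_p(R)]`, `R = L_∞(ℝ^d) ⊗ B(L₂(ν))`, of an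
`n × n` matrix of `S₂(L₂(ν))`-valued functions. For `p = ∞` it is the essential supremum of the
operator norms, i.e. the norm of `M_n(R)`. -/
def matrixLpNorm (p : ℝ≥0∞) {n : ℕ} (f : Matrix (Fin n) (Fin n) (L2HS ν d)) : ℝ≥0∞ :=
  eLpNorm (fun x : EuclideanSpace ℝ (Fin d) =>
    matrixSchattenNorm p (f.map fun fij => (fij x : HSKernel ν))) p volume

variable (ν)

/-- `‖T̃_M : L_p(R) → L_p(R)‖_cb` for `R = L_∞(ℝ^d) ⊗ B(L₂(ν))` and the twisted Fourier multiplier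
`T̃_M`, defined on `L₂(ℝ^d; S₂(L₂(ν))) ∩ L_p(R)`. -/
def twistedCbNorm (p : ℝ≥0∞) (M : G → EuclideanSpace ℝ (Fin d) → ℂ) : ℝ≥0∞ :=
  cbNorm (D := L2HS ν d) (IsTwistedMultiplierImage M) (fun _ f => matrixLpNorm p f)

end Twisted

end TwistedMultiplier

end

noncomputable section

namespace TwistedMultiplier

open BoundedContinuousFunction Filter SchwartzMap Topology

/-! ### Spectral calculus of compact operators -/

section Spectral

universe u

variable {H : Type u} [NormedAddCommGroup H] [InnerProductSpace ℂ H] [CompleteSpace H]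

/-! The cocycle law gives `β (g * h⁻¹) = α_g (β h⁻¹ - β g⁻¹)`. With `b(g,h) = β h⁻¹ - β g⁻¹`, the
Schur symbol at `(g,h)` is therefore the row symbol `M_g(ξ) = mdot (α_g ξ)` evaluated at the
frequency `ξ = b(g,h)`. To see this value, a kernel `a` is lifted to `f(x) = φ(x) (exp(2πi⟨x,
b(g,h)⟩) a_{gh})` (`twist`). Since `b` is a sum of a function of `g` and a function of `h`, the
modulation multiplies `a` on both sides by diagonal unitaries, so `f` has norm at most `‖φ‖_p ‖a‖`.
On the Fourier side it translates `φ̂` by `b(g,h)`, entry by entry (`fourier_twist`).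

Pairing `T̃ f` with the lift of another kernel `k` gives `⟨k, ∫ |φ̂(ξ)|² M_g(ξ + b(g,h)) a_{gh} dξ⟩`
(`inner_twist`), while Hölder in `x` bounds this by `C ‖φ‖_p ‖φ‖_q ‖a‖` when `k` represents a
norm-one functional. Replacing `φ` by wide dilates `φ(u x)`, `u → 0`, concentrates `|φ̂|²` at the
origin. All scaling factors cancel, and the limit is `‖φ‖₂² ‖S_m a‖ ≤ C ‖φ‖_p ‖φ‖_q ‖a‖`
(`matrixSchattenNorm_schurMul_transBCF_le`). Letting `φ` approach the indicator of a ball makes the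
ratio of norms tend to `1`, so no constant is lost.

Duality never leaves `L₂`: the Schatten norm of a compact operator is the supremum of `ℓ_p` norms of
`(⟨f_i, A e_i⟩)_i` over finite orthonormal families, and a functional of such a vector is
represented on Hilbert-Schmidt kernels by Riesz.

The argument needs bounded symbols, and boundedness is extracted from the finite bound itself:
testing on rank one kernels `1_U ⊗ 1_U` with frequencies near a point bounds the symbol there
(`exists_enorm_bound_of_twisted`). Since the group need be neither second countable nor σ-finite,
symbols are factored as `f(P g, Q h)`, with `P` valued in a second countable pseudometrizable space,
and kernels are handled row by row instead of through product measures. -/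

theorem cfcHom_apply_of_apply_eq_smul {T : H →L[ℂ] H} (hT : IsSelfAdjoint T) {v : H}
    {c : ℝ} (hc : c ∈ spectrum ℝ T) (hv : T v = (c : ℂ) • v) (f : C(spectrum ℝ T, ℝ)) :
    cfcHom hT f v = ((f ⟨c, hc⟩ : ℝ) : ℂ) • v := by
  induction f using ContinuousMap.induction_on_of_compact with
  | const r =>
    have : (ContinuousMap.const (spectrum ℝ T) r) = algebraMap ℝ C(spectrum ℝ T, ℝ) r := rfl
    rw [this, AlgHomClass.commutes, Algebra.algebraMap_eq_smul_one]
    simp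
  | id => rw [cfcHom_id hT]; simpa using hv
  | star_id => rw [map_star, cfcHom_id hT, hT.star_eq]; simpa using hv
  | add f g hf hg => rw [map_add, _root_.add_apply, hf, hg, ← add_smul]; simp
  | mul f g hf hg =>
    rw [map_mul, mul_apply_eq_comp, hg, map_smul, hf, smul_smul]
    simp [mul_comm]
  | frequently f hf =>
    -- The identity is preserved by the algebra operations, hence holds for polynomials in the
    -- spectral variable; closedness carries it to uniform limits.
    have hcl : IsClosed {g : C(spectrum ℝ T, ℝ) | cfcHom hT g v = ((g ⟨c, hc⟩ : ℝ) : ℂ) • v} := by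
      refine isClosed_eq ?_ ?_
      · exact ((ContinuousLinearMap.apply ℂ H v).continuous).comp (cfcHom_continuous hT)
      · exact (Complex.continuous_ofReal.comp (continuous_eval_const (⟨c, hc⟩ : spectrum ℝ T))).smul
          continuous_const
    have h := mem_closure_iff_frequently.2 hf
    exact hcl.closure_subset h

theorem cfc_apply_of_apply_eq_smul {T : H →L[ℂ] H} (hT : IsSelfAdjoint T) {v : H}
    {c : ℝ} (hv : T v = (c : ℂ) • v) {f : ℝ → ℝ} (hf : ContinuousOn f (spectrum ℝ T)) :
    cfc f T v = (f c : ℂ) • v := by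
  rcases eq_or_ne v 0 with rfl | hv0
  · simp
  have hc : c ∈ spectrum ℝ T := by
    rw [spectrum.mem_iff]
    rintro ⟨u, hu⟩
    have h1 : (u : H →L[ℂ] H) v = 0 := by
      rw [hu, _root_.sub_apply, hv, Algebra.algebraMap_eq_smul_one]
      simp
    have h2 : ((u⁻¹ : (H →L[ℂ] H)ˣ) : H →L[ℂ] H) ((u : H →L[ℂ] H) v) = v := by
      rw [← mul_apply_eq_comp, Units.inv_mul]; rfl
    rw [h1, map_zero] at h2
    exact hv0 h2.symm
  rw [cfc_apply f T hT hf, cfcHom_apply_of_apply_eq_smul hT hc hv]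
  rfl

/-- Eigenspaces of a compact symmetric operator are mutually orthogonal with total span; bases of
the separate eigenspaces are glued together. -/
theorem exists_hilbertBasis_of_isCompactOperator {T : H →L[ℂ] H} (hT : IsCompactOperator T)
    (hT' : T.IsSymmetric) :
    ∃ (ι : Type u) (b : HilbertBasis ι ℂ H) (c : ι → ℂ), ∀ i, T (b i) = c i • b i := by
  have hc : ∀ μ, CompleteSpace (Module.End.eigenspace (T : Module.End ℂ H) μ) := fun μ => by
    have : IsClosed (Module.End.eigenspace (T : Module.End ℂ H) μ : Set H) := by
      have : (Module.End.eigenspace (T : Module.End ℂ H) μ : Set H) = {x | T x = μ • x} := by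
        ext x; simp
      rw [this]
      exact isClosed_eq T.continuous (continuous_const_smul μ)
    exact this.completeSpace_coe
  choose w b hb using fun μ =>
    exists_hilbertBasis ℂ (Module.End.eigenspace (T : Module.End ℂ H) μ)
  have hON := hT'.orthogonalFamily_eigenspaces.orthonormal_sigma_orthonormal
    (fun μ => (b μ).orthonormal)
  refine ⟨Σ μ, w μ, HilbertBasis.mkOfOrthogonalEqBot hON ?_, fun a => a.1, ?_⟩
  · rw [eq_bot_iff, ← ContinuousLinearMap.orthogonalComplement_iSup_eigenspaces_eq_bot hT hT']
    intro x hx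
    rw [← Submodule.iInf_orthogonal, Submodule.mem_iInf]
    intro μ
    rw [Submodule.mem_orthogonal']
    intro u hu
    let L : Module.End.eigenspace (T : Module.End ℂ H) μ →L[ℂ] ℂ :=
      (innerSL ℂ x).comp (Submodule.subtypeL _)
    have hL : L = 0 := by
      refine ContinuousLinearMap.ext_on
        (Submodule.dense_iff_topologicalClosure_eq_top.2 (b μ).dense_span) ?_
      rintro _ ⟨i, rfl⟩
      have := Submodule.inner_left_of_mem_orthogonal
        (Submodule.subset_span (Set.mem_range_self (⟨μ, i⟩ : Σ μ, w μ))) hx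
      simpa [L] using this
    simpa [L] using DFunLike.congr_fun hL ⟨u, hu⟩
  · rintro ⟨μ, i⟩
    rw [HilbertBasis.coe_mkOfOrthogonalEqBot]
    exact Module.End.mem_eigenspace_iff.1 (b μ i).2

/-- An eigenbasis of `A* A`: its eigenvalues are `‖A b_i‖²`, so the `b_i` are right singular vectors
and every power of `|A|` is diagonal in them. -/
theorem exists_singular_basis {A : H →L[ℂ] H} (hA : IsCompactOperator A) :
    ∃ (ι : Type u) (b : HilbertBasis ι ℂ H),
      (∀ i j, i ≠ j → inner ℂ (A (b i)) (A (b j)) = 0) ∧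
      ∀ r : ℝ, 0 < r → ∀ i, (CFC.abs A ^ r) (b i) = ((‖A (b i)‖ ^ r : ℝ) : ℂ) • b i := by
  set T : H →L[ℂ] H := star A * A with hTdef
  have hTs : IsSelfAdjoint T := IsSelfAdjoint.star_mul_self A
  have hT0 : 0 ≤ T := star_mul_self_nonneg A
  have hTc : IsCompactOperator T := hA.clm_comp (star A)
  obtain ⟨ι, b, c, hc⟩ := exists_hilbertBasis_of_isCompactOperator hTc hTs.isSymmetric
  have hin : ∀ i j, inner ℂ (A (b i)) (A (b j)) = c j * inner ℂ (b i) (b j) := fun i j => by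
    rw [← ContinuousLinearMap.adjoint_inner_right, ← inner_smul_right, ← hc j]
    rfl
  have hc' : ∀ i, c i = ((‖A (b i)‖ ^ 2 : ℝ) : ℂ) := fun i => by
    have h1 := hin i i
    rw [inner_self_eq_norm_sq_to_K, inner_self_eq_norm_sq_to_K, b.orthonormal.1 i] at h1
    simpa using h1.symm
  refine ⟨ι, b, fun i j hij => by rw [hin, b.orthonormal.2 hij, mul_zero], fun r hr i => ?_⟩
  have h1 : CFC.abs A (b i) = ((‖A (b i)‖ : ℝ) : ℂ) • b i := by
    rw [CFC.abs, CFC.sqrt_eq_real_sqrt (star A * A) hT0, cfcₙ_eq_cfc,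
      cfc_apply_of_apply_eq_smul hTs (c := ‖A (b i)‖ ^ 2) (by rw [← hc' i]; exact hc i)
        Real.continuous_sqrt.continuousOn, Real.sqrt_sq (norm_nonneg _)]
  rw [CFC.rpow_eq_cfc_real (CFC.abs_nonneg A),
    cfc_apply_of_apply_eq_smul (CFC.abs_nonneg A).isSelfAdjoint h1
      (Real.continuous_rpow_const hr.le).continuousOn]

end Spectral

/-! ### Schatten norms as suprema over orthonormal families -/

section Norming

universe u

variable {H : Type u} [NormedAddCommGroup H] [InnerProductSpace ℂ H]

/-- Bessel's inequality with zero vectors allowed, because the left singular vectors of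
`exists_polar` vanish on the kernel of `A`. -/
theorem sum_norm_inner_sq_le {ι : Type*} {w : ι → H} (h1 : ∀ i, w i ≠ 0 → ‖w i‖ = 1)
    (h2 : ∀ i j, i ≠ j → inner ℂ (w i) (w j) = 0) (x : H) (s : Finset ι) :
    ∑ i ∈ s, ‖inner ℂ (w i) x‖ ^ 2 ≤ ‖x‖ ^ 2 := by
  classical
  have hON : Orthonormal ℂ (fun i : {i // w i ≠ 0} => w i) :=
    ⟨fun i => h1 i i.2, fun i j hij => h2 i j (fun h => hij (Subtype.ext h))⟩
  have h := hON.sum_inner_products_le x (s := s.subtype fun i => w i ≠ 0)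
  rwa [Finset.sum_subtype_eq_sum_filter (f := fun i => ‖inner ℂ (w i) x‖ ^ 2),
    Finset.sum_filter_of_ne] at h
  intro i _ hi hw
  simp [hw] at hi

theorem sum_norm_inner_mul_norm_inner_le {ι : Type*} {w v : ι → H}
    (h1 : ∀ i, w i ≠ 0 → ‖w i‖ = 1) (h2 : ∀ i j, i ≠ j → inner ℂ (w i) (w j) = 0)
    (h3 : ∀ i, v i ≠ 0 → ‖v i‖ = 1) (h4 : ∀ i j, i ≠ j → inner ℂ (v i) (v j) = 0)
    {x y : H} (hx : ‖x‖ ≤ 1) (hy : ‖y‖ ≤ 1) (s : Finset ι) :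
    ∑ i ∈ s, ‖inner ℂ (w i) x‖ * ‖inner ℂ (v i) y‖ ≤ 1 := by
  have hw := sum_norm_inner_sq_le h1 h2 x s
  have hv := sum_norm_inner_sq_le h3 h4 y s
  have : ∑ i ∈ s, ‖inner ℂ (w i) x‖ * ‖inner ℂ (v i) y‖ ≤
      ∑ i ∈ s, (‖inner ℂ (w i) x‖ ^ 2 + ‖inner ℂ (v i) y‖ ^ 2) / 2 :=
    Finset.sum_le_sum fun i _ => by
      nlinarith [sq_nonneg (‖inner ℂ (w i) x‖ - ‖inner ℂ (v i) y‖)]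
  rw [← Finset.sum_div, Finset.sum_add_distrib] at this
  have h5 : ‖x‖ ^ 2 ≤ 1 := pow_le_one₀ (norm_nonneg _) hx
  have h6 : ‖y‖ ^ 2 ≤ 1 := pow_le_one₀ (norm_nonneg _) hy
  linarith

theorem sum_enorm_inner_mul_enorm_inner_le {ι : Type*} {w v : ι → H}
    (h1 : ∀ i, w i ≠ 0 → ‖w i‖ = 1) (h2 : ∀ i j, i ≠ j → inner ℂ (w i) (w j) = 0)
    (h3 : ∀ i, v i ≠ 0 → ‖v i‖ = 1) (h4 : ∀ i j, i ≠ j → inner ℂ (v i) (v j) = 0)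
    {x y : H} (hx : ‖x‖ ≤ 1) (hy : ‖y‖ ≤ 1) (s : Finset ι) :
    ∑ i ∈ s, ‖inner ℂ (w i) x‖ₑ * ‖inner ℂ (v i) y‖ₑ ≤ 1 := by
  have h := ENNReal.ofReal_le_ofReal (sum_norm_inner_mul_norm_inner_le h1 h2 h3 h4 hx hy s)
  rw [ENNReal.ofReal_sum_of_nonneg (fun i _ => by positivity), ENNReal.ofReal_one] at h
  simpa only [ENNReal.ofReal_mul (norm_nonneg _), ofReal_norm] using h

theorem exists_polar {A : H →L[ℂ] H} {ι : Type*} {b : ι → H}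
    (hA : ∀ i j, i ≠ j → inner ℂ (A (b i)) (A (b j)) = 0) :
    ∃ w : ι → H, (∀ i, w i ≠ 0 → ‖w i‖ = 1) ∧ (∀ i j, i ≠ j → inner ℂ (w i) (w j) = 0) ∧
      (∀ i, A (b i) = (‖A (b i)‖ : ℂ) • w i) ∧ ∀ i, A (b i) ≠ 0 → w i ≠ 0 := by
  refine ⟨fun i => (‖A (b i)‖ : ℂ)⁻¹ • A (b i), fun i hi => ?_, fun i j hij => ?_, fun i => ?_,
    fun i hi => ?_⟩
  · have : A (b i) ≠ 0 := fun h => hi (by simp [h])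
    simp [norm_smul, this]
  · rw [inner_smul_left, inner_smul_right, hA i j hij]; simp
  · by_cases h : A (b i) = 0
    · simp [h]
    · rw [smul_smul, mul_inv_cancel₀ (by simpa using h), one_smul]
  · simp [hi]

variable [CompleteSpace H]

/-- The supremum defining the trace is attained on the eigenbasis: for any other finite orthonormal
family, expand in `b` and apply Bessel to each `b i`. -/
theorem opTrace_abs_rpow_eq_tsum {A : H →L[ℂ] H} {ι : Type*} (b : HilbertBasis ι ℂ H)
    {r : ℝ} (hr : 0 < r)
    (hb : ∀ i, (CFC.abs A ^ r) (b i) = ((‖A (b i)‖ ^ r : ℝ) : ℂ) • b i) :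
    opTrace (CFC.abs A ^ r) = ∑' i, ‖A (b i)‖ₑ ^ r := by
  classical
  set T := CFC.abs A ^ r with hT
  have hTs : IsSelfAdjoint T := IsSelfAdjoint.of_nonneg CFC.rpow_nonneg
  have hpow : ∀ i, ENNReal.ofReal (‖A (b i)‖ ^ r) = ‖A (b i)‖ₑ ^ r := fun i => by
    rw [← ENNReal.ofReal_rpow_of_nonneg (norm_nonneg _) hr.le, ofReal_norm]
  apply le_antisymm
  · refine iSup₂_le fun s hs => ?_
    have key : ∀ e : H, ENNReal.ofReal (inner ℂ (T e) e).re =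
        ∑' i, ‖A (b i)‖ₑ ^ r * ENNReal.ofReal (‖inner ℂ e (b i)‖ ^ 2) := fun e => by
      have h1 := b.hasSum_inner_mul_inner (T e) e
      have h2 : ∀ i, inner ℂ (T e) (b i) * inner ℂ (b i) e =
          ((‖A (b i)‖ ^ r * ‖inner ℂ e (b i)‖ ^ 2 : ℝ) : ℂ) := fun i => by
        have : inner ℂ (T e) (b i) = inner ℂ e (T (b i)) := hTs.isSymmetric e (b i)
        rw [this, hb, inner_smul_right, mul_assoc, ← inner_conj_symm (b i) e, Complex.mul_conj,
          Complex.normSq_eq_norm_sq]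
        push_cast; rfl
      simp_rw [h2] at h1
      have h3 := (Complex.hasSum_re h1)
      simp only [Complex.ofReal_re] at h3
      rw [← h3.tsum_eq, ENNReal.ofReal_tsum_of_nonneg (fun i => by positivity) h3.summable]
      refine tsum_congr fun i => ?_
      rw [ENNReal.ofReal_mul (by positivity), hpow]
    simp_rw [key]
    rw [← Summable.tsum_finsetSum (fun _ _ => ENNReal.summable)]
    refine ENNReal.tsum_le_tsum fun i => ?_
    rw [← Finset.mul_sum, ← ENNReal.ofReal_sum_of_nonneg (fun _ _ => by positivity)]
    refine mul_le_of_le_one_right' ?_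
    rw [← ENNReal.ofReal_one]
    refine ENNReal.ofReal_le_ofReal ?_
    have := hs.sum_inner_products_le (b i) (s := Finset.univ)
    rw [b.orthonormal.1 i, one_pow] at this
    rwa [← Finset.sum_coe_sort]
  · rw [ENNReal.tsum_eq_iSup_sum]
    refine iSup_le fun I => ?_
    have hinj : Function.Injective b := b.orthonormal.linearIndependent.injective
    have hs : Orthonormal ℂ (Subtype.val : ↥(I.image b) → H) := by
      have h := b.orthonormal.toSubtypeRange
      have hmem : ∀ e : ↥(I.image b), (e : H) ∈ Set.range b := fun e => by
        obtain ⟨i, -, hi⟩ := Finset.mem_image.1 e.2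
        exact ⟨i, hi⟩
      refine h.comp (fun e : ↥(I.image b) => (⟨e, hmem e⟩ : Set.range b)) fun e e' hee => ?_
      exact Subtype.ext (congrArg (fun z : Set.range b => (z : H)) hee)
    refine le_trans (le_of_eq ?_) (le_iSup₂ (f := fun (s : Finset H)
      (_ : Orthonormal ℂ (Subtype.val : s → H)) =>
        ∑ e ∈ s, ENNReal.ofReal (inner ℂ (T e) e).re) (I.image b) hs)
    rw [Finset.sum_image hinj.injOn]
    refine Finset.sum_congr rfl fun i _ => ?_
    rw [hb, inner_smul_left, inner_self_eq_norm_sq_to_K, b.orthonormal.1 i, ← hpow]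
    simp only [Complex.conj_ofReal, Complex.coe_algebraMap, Complex.ofReal_one, one_pow, mul_one,
      Complex.ofReal_re]

/-- The vector `(⟨f_i, A e_i⟩)_i` of `ℓ_p`. -/
def pairingVec (p : ℝ≥0∞) {n : ℕ} (e f : Fin n → H) (A : H →L[ℂ] H) :
    PiLp p (fun _ : Fin n => ℂ) :=
  WithLp.toLp p fun i => inner ℂ (f i) (A (e i))

theorem enorm_piLp_eq_sum {p : ℝ≥0∞} [Fact (1 ≤ p)] (hp : p ≠ ∞) {n : ℕ}
    (v : PiLp p (fun _ : Fin n => ℂ)) :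
    ‖v‖ₑ = (∑ i, ‖v i‖ₑ ^ p.toReal) ^ (1 / p.toReal) := by
  have hp0 : 0 < p.toReal :=
    ENNReal.toReal_pos (zero_lt_one.trans_le Fact.out).ne' hp
  rw [enorm_eq_nnnorm, PiLp.nnnorm_eq_sum hp, ENNReal.coe_rpow_of_nonneg _ (by positivity),
    ENNReal.ofNNReal_finsetSum]
  simp_rw [ENNReal.coe_rpow_of_nonneg _ hp0.le, enorm_eq_nnnorm]

/-- The singular value expansion writes `⟨f, A e⟩` as a sum of `‖A b_i‖` against weights of total
mass at most one, by Bessel and the arithmetic-geometric inequality. Convexity of `t ↦ t ^ r` then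
moves the power inside. -/
theorem enorm_inner_rpow_le {A : H →L[ℂ] H} {ι : Type*} (b : HilbertBasis ι ℂ H) {w : ι → H}
    (h1 : ∀ i, w i ≠ 0 → ‖w i‖ = 1) (h2 : ∀ i j, i ≠ j → inner ℂ (w i) (w j) = 0)
    (hAw : ∀ i, A (b i) = (‖A (b i)‖ : ℂ) • w i) {r : ℝ} (hr : 1 ≤ r)
    {e f : H} (he : ‖e‖ ≤ 1) (hf : ‖f‖ ≤ 1) :
    ‖inner ℂ f (A e)‖ₑ ^ r ≤
      ∑' i, ‖A (b i)‖ₑ ^ r * (‖inner ℂ (w i) f‖ₑ * ‖inner ℂ (b i) e‖ₑ) := by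
  have hr0 : 0 < r := zero_lt_one.trans_le hr
  have hs := b.hasSum_inner_mul_inner (A.adjoint f) e
  have h3 : ∀ i, inner ℂ (A.adjoint f) (b i) * inner ℂ (b i) e =
      (‖A (b i)‖ : ℂ) * (inner ℂ f (w i) * inner ℂ (b i) e) := fun i => by
    rw [ContinuousLinearMap.adjoint_inner_left, hAw, inner_smul_right, mul_assoc, ← hAw]
  simp_rw [h3] at hs
  rw [ContinuousLinearMap.adjoint_inner_left] at hs
  have h4 : ‖inner ℂ f (A e)‖ₑ ≤
      ∑' i, (‖inner ℂ (w i) f‖ₑ * ‖inner ℂ (b i) e‖ₑ) * ‖A (b i)‖ₑ := by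
    rw [← hs.tsum_eq]
    refine enorm_tsum_le_tsum_enorm.trans (le_of_eq (tsum_congr fun i => ?_))
    rw [enorm_mul, enorm_mul, mul_comm, ← inner_conj_symm (w i) f, RCLike.enorm_conj]
    rw [← ofReal_norm (‖A (b i)‖ : ℂ), Complex.norm_real, norm_norm, ofReal_norm]
  rw [← ENNReal.le_rpow_inv_iff hr0]
  refine h4.trans ?_
  rw [ENNReal.tsum_eq_iSup_sum]
  refine iSup_le fun I => ?_
  refine (ENNReal.inner_le_weight_mul_Lp_of_nonneg I hr _ _).trans ?_
  have h5 : (∑ i ∈ I, ‖inner ℂ (w i) f‖ₑ * ‖inner ℂ (b i) e‖ₑ) ^ (1 - r⁻¹) ≤ 1 := by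
    refine ENNReal.rpow_le_one ?_ (sub_nonneg.2 (inv_le_one_of_one_le₀ hr))
    exact sum_enorm_inner_mul_enorm_inner_le h1 h2 (fun i _ => b.orthonormal.1 i)
      (fun i j hij => b.orthonormal.2 hij) hf he I
  refine (mul_le_of_le_one_left' h5).trans ?_
  refine ENNReal.rpow_le_rpow ?_ (by positivity)
  simp_rw [mul_comm (_ * _) (_ ^ r)]
  exact ENNReal.sum_le_tsum I

/-- For finite `p`, sum the previous estimate over the families and exchange the sums: for each
fixed `i` the weights again add up to at most one, now by Bessel for `e` and `f`. -/
theorem enorm_pairingVec_le {p : ℝ≥0∞} [Fact (1 ≤ p)] {A : H →L[ℂ] H} (hA : IsCompactOperator A)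
    {n : ℕ} {e f : Fin n → H} (he : Orthonormal ℂ e) (hf : Orthonormal ℂ f) :
    ‖pairingVec p e f A‖ₑ ≤ schattenNorm p A := by
  by_cases hp : p = ∞
  · subst hp
    rw [schattenNorm, if_pos rfl, enorm_le_iff_norm_le, PiLp.norm_eq_ciSup]
    refine Real.iSup_le (fun i => ?_) (norm_nonneg _)
    refine (norm_inner_le_norm _ _).trans ?_
    rw [hf.1 i, one_mul]
    simpa [he.1 i] using A.le_opNorm (e i)
  obtain ⟨ι, b, hb1, hb2⟩ := exists_singular_basis hA
  obtain ⟨w, hw1, hw2, hw3, -⟩ := exists_polar hb1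
  have hp1 : 1 ≤ p.toReal := by
    rw [← ENNReal.toReal_one]
    exact ENNReal.toReal_mono hp Fact.out
  have hp0 : 0 < p.toReal := zero_lt_one.trans_le hp1
  rw [schattenNorm, if_neg hp, opTrace_abs_rpow_eq_tsum b hp0 (hb2 _ hp0), enorm_piLp_eq_sum hp]
  refine ENNReal.rpow_le_rpow ?_ (by positivity)
  calc ∑ j, ‖pairingVec p e f A j‖ₑ ^ p.toReal
      ≤ ∑ j, ∑' i, ‖A (b i)‖ₑ ^ p.toReal * (‖inner ℂ (w i) (f j)‖ₑ * ‖inner ℂ (b i) (e j)‖ₑ) :=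
        Finset.sum_le_sum fun j _ =>
          enorm_inner_rpow_le b hw1 hw2 hw3 hp1 (he.1 j).le (hf.1 j).le
    _ = ∑' i, ‖A (b i)‖ₑ ^ p.toReal *
          ∑ j, ‖inner ℂ (w i) (f j)‖ₑ * ‖inner ℂ (b i) (e j)‖ₑ := by
        rw [← Summable.tsum_finsetSum (fun _ _ => ENNReal.summable)]
        simp_rw [Finset.mul_sum]
    _ ≤ ∑' i, ‖A (b i)‖ₑ ^ p.toReal := by
        refine ENNReal.tsum_le_tsum fun i => mul_le_of_le_one_right' ?_
        have hwi : ‖w i‖ ≤ 1 := by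
          by_cases h : w i = 0
          · simp [h]
          · exact (hw1 i h).le
        have := sum_enorm_inner_mul_enorm_inner_le (fun j _ => hf.1 j) (fun j k hjk => hf.2 hjk)
          (fun j _ => he.1 j) (fun j k hjk => he.2 hjk) hwi (b.orthonormal.1 i).le Finset.univ
        refine le_trans (le_of_eq (Finset.sum_congr rfl fun j _ => ?_)) this
        rw [← inner_conj_symm (w i) (f j), ← inner_conj_symm (b i) (e j), RCLike.enorm_conj,
          RCLike.enorm_conj]

/-- The converse norming statement. For finite `p` the right and left singular vectors attain the
partial sums; for `p = ∞` the one-element families `x/‖x‖`, `A x/‖A x‖` suffice. -/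
theorem schattenNorm_le_of_pairingVec_le {p : ℝ≥0∞} [Fact (1 ≤ p)] {A : H →L[ℂ] H}
    (hA : IsCompactOperator A) {B : ℝ≥0∞}
    (h : ∀ (n : ℕ) (e f : Fin n → H), Orthonormal ℂ e → Orthonormal ℂ f →
      ‖pairingVec p e f A‖ₑ ≤ B) : schattenNorm p A ≤ B := by
  classical
  by_cases hB : B = ∞
  · simp [hB]
  by_cases hp : p = ∞
  · subst hp
    rw [schattenNorm, if_pos rfl, ← ENNReal.ofReal_toReal hB, ← ofReal_norm]
    refine ENNReal.ofReal_le_ofReal (A.opNorm_le_bound ENNReal.toReal_nonneg fun x => ?_)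
    by_cases hx : x = 0
    · simp [hx]
    by_cases hAx : A x = 0
    · simpa [hAx] using mul_nonneg ENNReal.toReal_nonneg (norm_nonneg x)
    have hunit : ∀ y : H, y ≠ 0 → Orthonormal ℂ (fun _ : Fin 1 => (‖y‖ : ℂ)⁻¹ • y) := fun y hy =>
      ⟨fun _ => by simp [norm_smul, hy], fun i j hij => absurd (Subsingleton.elim i j) hij⟩
    have h1 := h 1 _ _ (hunit x hx) (hunit (A x) hAx)
    rw [← ENNReal.ofReal_toReal hB, ← ofReal_norm,
      ENNReal.ofReal_le_ofReal_iff ENNReal.toReal_nonneg, PiLp.norm_eq_ciSup] at h1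
    have h2 := (le_ciSup (Set.finite_range _).bddAbove (0 : Fin 1)).trans h1
    simp only [pairingVec, map_smul, inner_smul_left, inner_smul_right,
      inner_self_eq_norm_sq_to_K, norm_mul, norm_pow] at h2
    have hx' : 0 < ‖x‖ := norm_pos_iff.2 hx
    have hAx' : 0 < ‖A x‖ := norm_pos_iff.2 hAx
    simp only [map_inv₀, Complex.conj_ofReal, norm_inv, Complex.norm_real, norm_norm,
      Complex.coe_algebraMap] at h2
    rw [← div_le_iff₀ hx']
    refine le_trans (le_of_eq ?_) h2
    field_simp
  obtain ⟨ι, b, hb1, hb2⟩ := exists_singular_basis hA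
  obtain ⟨w, hw1, hw2, hw3, hw4⟩ := exists_polar hb1
  have hp0 : 0 < p.toReal :=
    ENNReal.toReal_pos (zero_lt_one.trans_le Fact.out).ne' hp
  rw [schattenNorm, if_neg hp, opTrace_abs_rpow_eq_tsum b hp0 (hb2 _ hp0), one_div,
    ENNReal.rpow_inv_le_iff hp0, ENNReal.tsum_eq_iSup_sum]
  refine iSup_le fun I => ?_
  -- Indices with `A b_i = 0` contribute nothing, and their left vectors are zero, so they are
  -- dropped to keep an orthonormal family.
  set J := I.filter fun i => A (b i) ≠ 0 with hJ
  let φ : Fin J.card ≃ J := J.equivFin.symm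
  have hφ : Function.Injective fun k => (φ k : ι) := Subtype.val_injective.comp φ.injective
  have hw : ∀ k, w (φ k) ≠ 0 := fun k => hw4 _ (Finset.mem_filter.1 (φ k).2).2
  have h1 := h J.card (fun k => b (φ k)) (fun k => w (φ k)) (b.orthonormal.comp _ hφ)
    ⟨fun k => hw1 _ (hw k), fun k l hkl => hw2 _ _ (hφ.ne hkl)⟩
  rw [enorm_piLp_eq_sum hp, one_div, ENNReal.rpow_inv_le_iff hp0] at h1
  refine le_trans (le_of_eq ?_) h1
  have h2 : ∀ k, ‖pairingVec p (fun k => b (φ k)) (fun k => w (φ k)) A k‖ₑ = ‖A (b (φ k))‖ₑ :=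
    fun k => by
      have : pairingVec p (fun k => b (φ k)) (fun k => w (φ k)) A k =
        inner ℂ (w (φ k)) (A (b (φ k))) := rfl
      rw [this, hw3 (φ k), inner_smul_right, inner_self_eq_norm_sq_to_K, hw1 _ (hw k), enorm_smul,
        hw3 (φ k)]
      simp [← ofReal_norm, hw1 _ (hw k), norm_smul]
  simp_rw [h2]
  rw [Equiv.sum_comp φ (fun i : J => ‖A (b i)‖ₑ ^ p.toReal),
    Finset.sum_coe_sort J (fun i => ‖A (b i)‖ₑ ^ p.toReal), hJ, Finset.sum_filter_of_ne]
  intro i _ hi h0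
  simp [h0, hp0] at hi

end Norming

/-! ### Isometric compressions and block operators -/

section Isometry

variable {H : Type*} [NormedAddCommGroup H] [InnerProductSpace ℂ H]

/-- Here `B = c U* A V`; isometries carry orthonormal families to orthonormal families, so the
norming description gives the bound at once. -/
theorem schattenNorm_le_of_inner_eq [CompleteSpace H] {p : ℝ≥0∞} [Fact (1 ≤ p)] {A B : H →L[ℂ] H}
    (hA : IsCompactOperator A) (hB : IsCompactOperator B) (U V : H →ₗᵢ[ℂ] H) (c : ℂ)
    (h : ∀ x y, inner ℂ y (B x) = c * inner ℂ (U y) (A (V x))) :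
    schattenNorm p B ≤ ‖c‖ₑ * schattenNorm p A := by
  refine schattenNorm_le_of_pairingVec_le hB fun n e f he hf => ?_
  have : pairingVec p e f B = c • pairingVec p (V ∘ e) (U ∘ f) A := by
    ext i; simp [pairingVec, h]
  rw [this, enorm_smul]
  gcongr
  exact enorm_pairingVec_le hA (he.comp_linearIsometry V) (hf.comp_linearIsometry U)

/-- The coordinatewise action of an isometry on a finite Hilbert sum. -/
def piLpIsometry (n : ℕ) (U : H →ₗᵢ[ℂ] H) :
    PiLp 2 (fun _ : Fin n => H) →ₗᵢ[ℂ] PiLp 2 (fun _ : Fin n => H) where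
  toFun x := WithLp.toLp 2 fun i => U (x i)
  map_add' x y := by ext i; simp
  map_smul' c x := by ext i; simp
  norm_map' x := by simp [PiLp.norm_eq_of_L2]

theorem isCompactOperator_finsetSum {ι : Type*} (s : Finset ι) {E F : Type*}
    [NormedAddCommGroup E] [NormedSpace ℂ E] [NormedAddCommGroup F] [NormedSpace ℂ F]
    {A : ι → E →L[ℂ] F} (h : ∀ i ∈ s, IsCompactOperator (A i)) :
    IsCompactOperator (∑ i ∈ s, A i : E →L[ℂ] F) := by
  classical
  induction s using Finset.induction_on with
  | empty => exact isCompactOperator_zero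
  | insert a s ha ih =>
    rw [Finset.sum_insert ha]
    exact (h a (Finset.mem_insert_self a s)).add
      (ih fun i hi => h i (Finset.mem_insert_of_mem hi))

theorem blockOp_eq_sum {n : ℕ} (A : Matrix (Fin n) (Fin n) (H →L[ℂ] H)) :
    blockOp A = ∑ i, ∑ j,
      (((PiLp.continuousLinearEquiv 2 ℂ (fun _ : Fin n => H)).symm :
        (Fin n → H) →L[ℂ] PiLp 2 (fun _ : Fin n => H)) ∘L
        ContinuousLinearMap.single ℂ (fun _ : Fin n => H) i) ∘L
      A i j ∘L PiLp.proj 2 (fun _ : Fin n => H) j := by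
  ext x k
  rw [blockOp_apply]
  simp [Pi.single_apply, Finset.sum_apply]

theorem isCompactOperator_blockOp {n : ℕ} {A : Matrix (Fin n) (Fin n) (H →L[ℂ] H)}
    (h : ∀ i j, IsCompactOperator (A i j)) : IsCompactOperator (blockOp A) := by
  rw [blockOp_eq_sum]
  refine isCompactOperator_finsetSum _ fun i _ => isCompactOperator_finsetSum _ fun j _ => ?_
  exact ((h i j).comp_clm (PiLp.proj 2 (fun _ : Fin n => H) j)).clm_comp
    (((PiLp.continuousLinearEquiv 2 ℂ (fun _ : Fin n => H)).symm :
        (Fin n → H) →L[ℂ] PiLp 2 (fun _ : Fin n => H)) ∘L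
        ContinuousLinearMap.single ℂ (fun _ : Fin n => H) i)

theorem inner_blockOp {n : ℕ} (A : Matrix (Fin n) (Fin n) (H →L[ℂ] H))
    (x y : PiLp 2 (fun _ : Fin n => H)) :
    inner ℂ y (blockOp A x) = ∑ i, ∑ j, inner ℂ (y i) (A i j (x j)) := by
  rw [PiLp.inner_apply]
  refine Finset.sum_congr rfl fun i _ => ?_
  rw [blockOp_apply, inner_sum]

end Isometry

/-! ### Kernel operators are compact -/

section Kernel

variable {X : Type*} [MeasurableSpace X] {ν : Measure X}

theorem norm_kernelOp_le (k : HSKernel ν) : ‖kernelOp k‖ ≤ ‖k‖ :=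
  LinearMap.mkContinuous_norm_le _ (norm_nonneg _) _

/-- The inclusion of the Hilbert-Schmidt kernels into the bounded operators. -/
def kernelOpL : HSKernel ν →L[ℂ] (Lp ℂ 2 ν →L[ℂ] Lp ℂ 2 ν) :=
  LinearMap.mkContinuous
    { toFun := kernelOp
      map_add' := fun k l => by
        ext1 η
        exact ((pairing η).compLpₗ 2 ν).map_add k l
      map_smul' := fun c k => by
        ext1 η
        exact ((pairing η).compLpₗ 2 ν).map_smul c k }
    1 (fun k => by rw [one_mul]; exact norm_kernelOp_le k)

@[simp] theorem kernelOpL_apply (k : HSKernel ν) : kernelOpL k = kernelOp k := rfl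

theorem pairing_comm (η ζ : Lp ℂ 2 ν) : pairing η ζ = pairing ζ η := by
  simp_rw [pairing_apply, mul_comm]

theorem kernelOp_indicatorConstLp {s : Set X} (hs : MeasurableSet s) (hν : ν s ≠ ∞)
    (v η : Lp ℂ 2 ν) :
    kernelOp (indicatorConstLp 2 hs hν v) η = pairing v η • indicatorConstLp 2 hs hν (1 : ℂ) := by
  have h1 : kernelOp (indicatorConstLp 2 hs hν v) η =
    (pairing η).compLp (indicatorConstLp 2 hs hν v) := rfl
  rw [h1]
  refine Lp.ext ?_
  filter_upwards [ContinuousLinearMap.coeFn_compLp (pairing η) (indicatorConstLp 2 hs hν v),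
    indicatorConstLp_coeFn (p := 2) (hs := hs) (hμs := hν) (c := v),
    indicatorConstLp_coeFn (p := 2) (hs := hs) (hμs := hν) (c := (1 : ℂ)),
    Lp.coeFn_smul (pairing v η) (indicatorConstLp 2 hs hν (1 : ℂ))] with g h2 h3 h4 h5
  rw [h2, h5, h3, Pi.smul_apply, h4]
  by_cases hg : g ∈ s
  · simp [hg, pairing_comm]
  · simp [hg]

theorem isCompactOperator_smulRight {E F : Type*} [NormedAddCommGroup E] [NormedSpace ℂ E]
    [NormedAddCommGroup F] [NormedSpace ℂ F] (L : E →L[ℂ] ℂ) (w : F) :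
    IsCompactOperator (L.smulRight w) :=
  (isCompactOperator_of_locallyCompactSpace_dom L).clm_comp
    (ContinuousLinearMap.toSpanSingleton ℂ w)

/-- Step kernels are sums of rank one operators; compactness passes to limits because the operator
norm is dominated by the Hilbert-Schmidt norm. -/
theorem isCompactOperator_kernelOp (k : HSKernel ν) : IsCompactOperator (kernelOp k) := by
  induction k using Lp.induction (p := 2) ENNReal.ofNat_ne_top with
  | indicatorConst v hs hν =>
    have : kernelOp (indicatorConstLp 2 hs hν.ne v) =
        (pairing v).smulRight (indicatorConstLp 2 hs hν.ne (1 : ℂ)) := by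
      ext1 η
      exact kernelOp_indicatorConstLp hs hν.ne v η
    rw [Lp.simpleFunc.coe_indicatorConst, this]
    exact isCompactOperator_smulRight _ _
  | add hf hg hd h1 h2 =>
    have := h1.add h2
    rwa [← FunLike.coe_add, ← kernelOpL_apply, ← kernelOpL_apply, ← map_add] at this
  | isClosed => exact isClosed_setOfPred_isCompactOperator.preimage kernelOpL.continuous

theorem isCompactOperator_blockOp_kernelOp {n : ℕ} (a : Matrix (Fin n) (Fin n) (HSKernel ν)) :
    IsCompactOperator (blockOp (a.map kernelOp)) :=
  isCompactOperator_blockOp fun i j => isCompactOperator_kernelOp (a i j)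

end Kernel

/-! ### Decomposable operators on vector-valued `L₂` -/

section OpMul

variable {X : Type*} [MeasurableSpace X] {ν : Measure X}
  {F : Type*} [NormedAddCommGroup F] [NormedSpace ℂ F]

/-- A uniformly bounded measurable field of operators on `F`. -/
structure BoundedField (ν : Measure X) (K : ℝ) (R : X → F →L[ℂ] F) : Prop where
  nonneg : 0 ≤ K
  bound : ∀ g, ‖R g‖ ≤ K
  meas : ∀ u : X → F, AEStronglyMeasurable u ν → AEStronglyMeasurable (fun g => R g (u g)) ν

namespace BoundedField

variable {K : ℝ} {R : X → F →L[ℂ] F} (h : BoundedField ν K R)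
include h

theorem norm_apply_le (g : X) (v : F) : ‖R g v‖ ≤ K * ‖v‖ :=
  (R g).le_of_opNorm_le (h.bound g) v

theorem memLp (f : Lp F 2 ν) : MemLp (fun g => R g (f g)) 2 ν :=
  (Lp.memLp f).of_le_mul (h.meas f (Lp.aestronglyMeasurable f))
    (Eventually.of_forall fun g => h.norm_apply_le g (f g))

/-- The decomposable operator `f ↦ (g ↦ R_g (f g))` on `L₂(ν; F)`. -/
def opMul : Lp F 2 ν →L[ℂ] Lp F 2 ν :=
  LinearMap.mkContinuous
    { toFun := fun f => (h.memLp f).toLp _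
      map_add' := fun f f' => by
        refine Lp.ext ?_
        filter_upwards [(h.memLp (f + f')).coeFn_toLp, (h.memLp f).coeFn_toLp,
          (h.memLp f').coeFn_toLp, Lp.coeFn_add f f',
          Lp.coeFn_add ((h.memLp f).toLp _) ((h.memLp f').toLp _)] with g h1 h2 h3 h4 h5
        rw [h1, h5, Pi.add_apply, h2, h3, h4, Pi.add_apply, map_add]
      map_smul' := fun c f => by
        refine Lp.ext ?_
        filter_upwards [(h.memLp (c • f)).coeFn_toLp, (h.memLp f).coeFn_toLp, Lp.coeFn_smul c f,
          Lp.coeFn_smul c ((h.memLp f).toLp _)] with g h1 h2 h3 h4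
        rw [h1, RingHom.id_apply, h4, Pi.smul_apply, h2, h3, Pi.smul_apply, map_smul] }
    K (fun f => by
      refine Lp.norm_le_mul_norm_of_ae_le_mul ?_
      filter_upwards [(h.memLp f).coeFn_toLp] with g h1
      simp only [LinearMap.coe_mk, AddHom.coe_mk, h1]
      exact h.norm_apply_le g (f g))

theorem coeFn_opMul (f : Lp F 2 ν) : h.opMul f =ᵐ[ν] fun g => R g (f g) :=
  (h.memLp f).coeFn_toLp

theorem norm_opMul_le : ‖h.opMul‖ ≤ K := LinearMap.mkContinuous_norm_le _ h.nonneg _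

theorem norm_opMul_apply_le (f : Lp F 2 ν) : ‖h.opMul f‖ ≤ K * ‖f‖ :=
  h.opMul.le_of_opNorm_le h.norm_opMul_le f

omit h in
-- Dominated convergence with majorant `(2K ‖f g‖)²`. Strong pointwise convergence suffices, which
-- matters because row multipliers are not norm continuous in their parameter.
theorem tendsto_opMul {ι : Type*} {l : Filter ι} [l.IsCountablyGenerated] {R' : ι → X → F →L[ℂ] F}
    (h' : ∀ i, BoundedField ν K (R' i)) (h : BoundedField ν K R) (f : Lp F 2 ν)
    (hlim : ∀ᵐ g ∂ν, Tendsto (fun i => R' i g (f g)) l (𝓝 (R g (f g)))) :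
    Tendsto (fun i => (h' i).opMul f) l (𝓝 (h.opMul f)) := by
  rw [Lp.tendsto_Lp_iff_tendsto_eLpNorm']
  have key : ∀ i, eLpNorm (⇑((h' i).opMul f) - ⇑(h.opMul f)) 2 ν =
      (∫⁻ g, ‖R' i g (f g) - R g (f g)‖ₑ ^ (2 : ℝ) ∂ν) ^ (1 / (2 : ℝ)) := fun i => by
    rw [eLpNorm_eq_lintegral_rpow_enorm_toReal (by norm_num) (by norm_num)]
    simp only [ENNReal.toReal_ofNat]
    congr 1
    refine lintegral_congr_ae ?_
    filter_upwards [(h' i).coeFn_opMul f, h.coeFn_opMul f] with g h1 h2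
    rw [Pi.sub_apply, h1, h2]
  simp_rw [key]
  have hz : (0 : ℝ≥0∞) = 0 ^ (1 / (2 : ℝ)) := by simp
  rw [hz]
  refine (ENNReal.continuous_rpow_const.tendsto _).comp ?_
  have hz' : (0 : ℝ≥0∞) = ∫⁻ _, 0 ∂ν := by simp
  rw [hz']
  refine tendsto_lintegral_filter_of_dominated_convergence'
    (fun g => (ENNReal.ofReal (2 * K) * ‖f g‖ₑ) ^ (2 : ℝ)) ?_ ?_ ?_ ?_
  · exact Eventually.of_forall fun i =>
      ((((h' i).memLp f).1.sub (h.memLp f).1).enorm.pow_const _)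
  · refine Eventually.of_forall fun i => Eventually.of_forall fun g => ?_
    refine ENNReal.rpow_le_rpow ?_ (by norm_num)
    rw [← ofReal_norm, ← ofReal_norm, ← ENNReal.ofReal_mul (by linarith [h.nonneg])]
    refine ENNReal.ofReal_le_ofReal ((norm_sub_le _ _).trans ?_)
    linarith [(h' i).norm_apply_le g (f g), h.norm_apply_le g (f g)]
  · simp_rw [ENNReal.mul_rpow_of_nonneg _ _ (show (0 : ℝ) ≤ 2 by norm_num)]
    rw [lintegral_const_mul' _ _ (by finiteness)]
    refine ENNReal.mul_ne_top (by finiteness) ?_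
    have := (lintegral_rpow_enorm_lt_top_of_eLpNorm_lt_top (by norm_num) (by norm_num)
      (Lp.memLp f).2).ne
    simpa using this
  · filter_upwards [hlim] with g hg
    have h0 : (0 : ℝ≥0∞) = ‖R g (f g) - R g (f g)‖ₑ ^ (2 : ℝ) := by simp
    rw [h0]
    exact (ENNReal.continuous_rpow_const.tendsto _).comp
      ((continuous_enorm.tendsto _).comp (hg.sub_const _))

end BoundedField

theorem continuous_uncurry_of_strongly_continuous {E E' S : Type*} [NormedAddCommGroup E]
    [NormedSpace ℂ E] [NormedAddCommGroup E'] [NormedSpace ℂ E'] [TopologicalSpace S] {K : ℝ}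
    {A : S → E →L[ℂ] E'} (hA : ∀ s, ‖A s‖ ≤ K) (hc : ∀ v, Continuous fun s => A s v) :
    Continuous fun z : S × E => A z.1 z.2 := by
  rw [continuous_iff_continuousAt]
  rintro ⟨s, v⟩
  have h1 : Tendsto (fun z : S × E => A z.1 (z.2 - v)) (𝓝 (s, v)) (𝓝 0) := by
    refine squeeze_zero_norm (a := fun z => K * ‖z.2 - v‖)
      (fun z => (A z.1).le_of_opNorm_le (hA z.1) _) ?_
    have : Continuous fun z : S × E => K * ‖z.2 - v‖ := by fun_prop
    simpa using this.tendsto (s, v)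
  have h2 : Tendsto (fun z : S × E => A z.1 v) (𝓝 (s, v)) (𝓝 (A s v)) :=
    ((hc v).comp continuous_fst).tendsto (s, v)
  have := h1.add h2
  rw [zero_add] at this
  refine this.congr fun z => ?_
  rw [← map_add, sub_add_cancel]

/-- Passing through a second countable parameter space makes the field strongly measurable without
any countability assumption on `X`. -/
theorem boundedField_of_strongly_continuous {S : Type*} [TopologicalSpace S]
    [SecondCountableTopology S] [TopologicalSpace.PseudoMetrizableSpace S] [MeasurableSpace S]
    [BorelSpace S] {P : X → S} (hP : Measurable P) {K : ℝ} (hK : 0 ≤ K) {A : S → F →L[ℂ] F}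
    (hA : ∀ s, ‖A s‖ ≤ K) (hc : ∀ v, Continuous fun s => A s v) :
    BoundedField ν K (fun g => A (P g)) where
  nonneg := hK
  bound g := hA (P g)
  meas _ hu := (continuous_uncurry_of_strongly_continuous hA hc).comp_aestronglyMeasurable
    ((hP.stronglyMeasurable.aestronglyMeasurable).prodMk hu)

end OpMul

/-! ### Schur multipliers with bounded continuous symbols -/

section Schur

variable {X : Type*} [MeasurableSpace X] {ν : Measure X}

theorem boundedField_smul {c : X → ℂ} (hc : AEStronglyMeasurable c ν) {K : ℝ} (hK : 0 ≤ K)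
    (hb : ∀ x, ‖c x‖ ≤ K) {F : Type*} [NormedAddCommGroup F] [NormedSpace ℂ F] :
    BoundedField ν K (fun x => c x • ContinuousLinearMap.id ℂ F) where
  nonneg := hK
  bound x := by
    rw [norm_smul]
    exact (mul_le_of_le_one_right (norm_nonneg _) ContinuousLinearMap.norm_id_le).trans (hb x)
  meas u hu := hc.smul hu

variable {S T : Type*} [TopologicalSpace S] [TopologicalSpace T] [MeasurableSpace T] [BorelSpace T]
  {P : X → S} {Q : X → T}

theorem boundedField_row (hQ : Measurable Q) (f : S × T →ᵇ ℂ) (s : S) :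
    BoundedField ν ‖f‖ (fun h => f (s, Q h) • ContinuousLinearMap.id ℂ ℂ) :=
  boundedField_smul
    ((f.continuous.comp (Continuous.prodMk_right s)).measurable.comp hQ).aestronglyMeasurable
    (norm_nonneg f) (fun _ => f.norm_coe_le_norm _)

/-- Multiplication of a row by `h ↦ f(s, Q h)`. -/
def rowMul (hQ : Measurable Q) (f : S × T →ᵇ ℂ) (s : S) : Lp ℂ 2 ν →L[ℂ] Lp ℂ 2 ν :=
  (boundedField_row hQ f s).opMul

theorem coeFn_rowMul (hQ : Measurable Q) (f : S × T →ᵇ ℂ) (s : S) (v : Lp ℂ 2 ν) :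
    rowMul hQ f s v =ᵐ[ν] fun h => f (s, Q h) * v h := by
  filter_upwards [(boundedField_row (ν := ν) hQ f s).coeFn_opMul v] with h hh
  rw [rowMul, hh]; rfl

theorem tendsto_rowMul (hQ : Measurable Q) {ι : Type*} {l : Filter ι} [l.IsCountablyGenerated]
    {f' : ι → S × T →ᵇ ℂ} {f : S × T →ᵇ ℂ} {K : ℝ} (hK : ∀ i, ‖f' i‖ ≤ K) (hf : ‖f‖ ≤ K)
    {s' : ι → S} {s : S} (hlim : ∀ t, Tendsto (fun i => f' i (s' i, t)) l (𝓝 (f (s, t))))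
    (v : Lp ℂ 2 ν) :
    Tendsto (fun i => rowMul hQ (f' i) (s' i) v) l (𝓝 (rowMul hQ f s v)) := by
  have hb : ∀ (f : S × T →ᵇ ℂ) (s : S), ‖f‖ ≤ K →
      BoundedField ν K (fun h => f (s, Q h) • ContinuousLinearMap.id ℂ ℂ) := fun f s hf =>
    { boundedField_row hQ f s with
      nonneg := (norm_nonneg f).trans hf
      bound := fun h => ((boundedField_row (ν := ν) hQ f s).bound h).trans hf }
  exact BoundedField.tendsto_opMul (fun i => hb (f' i) (s' i) (hK i)) (hb f s hf) v
    (Eventually.of_forall fun h => (hlim (Q h)).smul_const _)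

theorem norm_rowMul_le (hQ : Measurable Q) (f : S × T →ᵇ ℂ) (s : S) :
    ‖(rowMul hQ f s : Lp ℂ 2 ν →L[ℂ] Lp ℂ 2 ν)‖ ≤ ‖f‖ :=
  (boundedField_row hQ f s).norm_opMul_le

variable [SecondCountableTopology S] [TopologicalSpace.PseudoMetrizableSpace S]
  [MeasurableSpace S] [BorelSpace S]

theorem boundedField_rowMul (hP : Measurable P) (hQ : Measurable Q) (f : S × T →ᵇ ℂ) :
    BoundedField ν ‖f‖ (fun g => (rowMul hQ f (P g) : Lp ℂ 2 ν →L[ℂ] Lp ℂ 2 ν)) :=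
  boundedField_of_strongly_continuous hP (norm_nonneg f) (norm_rowMul_le hQ f) fun v =>
    continuous_iff_continuousAt.2 fun s =>
      tendsto_rowMul hQ (f' := fun _ => f) (K := ‖f‖) (fun _ => le_rfl) le_rfl
        (fun t => (f.continuous.comp (Continuous.prodMk_left t)).tendsto s) v

/-- The Schur multiplier with symbol `(g, h) ↦ f(P g, Q h)` on the Hilbert-Schmidt kernels. -/
def schurMul (hP : Measurable P) (hQ : Measurable Q) (f : S × T →ᵇ ℂ) :
    HSKernel ν →L[ℂ] HSKernel ν :=
  (boundedField_rowMul hP hQ f).opMul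

variable (hP : Measurable P) (hQ : Measurable Q)

theorem coeFn_schurMul (f : S × T →ᵇ ℂ) (a : HSKernel ν) :
    schurMul hP hQ f a =ᵐ[ν] fun g => rowMul hQ f (P g) (a g) :=
  (boundedField_rowMul hP hQ f).coeFn_opMul a

theorem isSchurProduct_schurMul (f : S × T →ᵇ ℂ) (a : HSKernel ν) :
    IsSchurProduct (fun g h => f (P g, Q h)) a (schurMul hP hQ f a) := by
  filter_upwards [coeFn_schurMul hP hQ f a] with g hg
  rw [hg]
  exact coeFn_rowMul hQ f (P g) (a g)

/-- A symbol and a kernel determine their Schur product, so the algebraic rules for `schurMul` can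
be checked on symbols. -/
theorem IsSchurProduct.eq {s : X → X → ℂ} {a k k' : HSKernel ν} (h : IsSchurProduct s a k)
    (h' : IsSchurProduct s a k') : k = k' := by
  refine Lp.ext ?_
  filter_upwards [h, h'] with g h1 h2
  refine Lp.ext ?_
  filter_upwards [h1, h2] with h h3 h4
  rw [h3, h4]

theorem IsSchurProduct.eq_schurMul {f : S × T →ᵇ ℂ} {a k : HSKernel ν}
    (h : IsSchurProduct (fun g h => f (P g, Q h)) a k) : k = schurMul hP hQ f a :=
  h.eq (isSchurProduct_schurMul hP hQ f a)

theorem IsSchurProduct.mul {s s' : X → X → ℂ} {a k k' : HSKernel ν} (h : IsSchurProduct s a k)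
    (h' : IsSchurProduct s' k k') : IsSchurProduct (fun g h => s' g h * s g h) a k' := by
  filter_upwards [h, h'] with g h1 h2
  filter_upwards [h1, h2] with h h3 h4
  rw [h4, h3, mul_assoc]

theorem IsSchurProduct.add_symbol {s s' : X → X → ℂ} {a k k' : HSKernel ν}
    (h : IsSchurProduct s a k) (h' : IsSchurProduct s' a k') :
    IsSchurProduct (fun g h => s g h + s' g h) a (k + k') := by
  filter_upwards [h, h', Lp.coeFn_add k k'] with g h1 h2 h3
  rw [h3]
  filter_upwards [h1, h2, Lp.coeFn_add (k g) (k' g)] with h h4 h5 h6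
  rw [Pi.add_apply, h6, Pi.add_apply, h4, h5, add_mul]

theorem IsSchurProduct.smul_symbol {s : X → X → ℂ} {a k : HSKernel ν} (c : ℂ)
    (h : IsSchurProduct s a k) : IsSchurProduct (fun g h => c * s g h) a (c • k) := by
  filter_upwards [h, Lp.coeFn_smul c k] with g h1 h3
  rw [h3]
  filter_upwards [h1, Lp.coeFn_smul c (k g)] with h h4 h6
  rw [Pi.smul_apply, h6, Pi.smul_apply, h4, smul_eq_mul, mul_assoc]

theorem schurMul_mul (f f' : S × T →ᵇ ℂ) (a : HSKernel ν) :
    schurMul hP hQ (f * f') a = schurMul hP hQ f (schurMul hP hQ f' a) :=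
  (((isSchurProduct_schurMul hP hQ f' a).mul
    (isSchurProduct_schurMul hP hQ f _)).eq_schurMul hP hQ (f := f * f')).symm

theorem schurMul_add (f f' : S × T →ᵇ ℂ) (a : HSKernel ν) :
    schurMul hP hQ (f + f') a = schurMul hP hQ f a + schurMul hP hQ f' a :=
  (((isSchurProduct_schurMul hP hQ f a).add_symbol
    (isSchurProduct_schurMul hP hQ f' a)).eq_schurMul hP hQ (f := f + f')).symm

theorem schurMul_smul (c : ℂ) (f : S × T →ᵇ ℂ) (a : HSKernel ν) :
    schurMul hP hQ (c • f) a = c • schurMul hP hQ f a :=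
  (((isSchurProduct_schurMul hP hQ f a).smul_symbol c).eq_schurMul hP hQ (f := c • f)).symm

theorem schurMul_one (a : HSKernel ν) : schurMul hP hQ (1 : S × T →ᵇ ℂ) a = a := by
  refine (IsSchurProduct.eq_schurMul hP hQ (f := 1) ?_).symm
  exact Eventually.of_forall fun g => Eventually.of_forall fun h => by simp

theorem norm_schurMul_apply_le (f : S × T →ᵇ ℂ) (a : HSKernel ν) :
    ‖schurMul hP hQ f a‖ ≤ ‖f‖ * ‖a‖ :=
  (boundedField_rowMul hP hQ f).norm_opMul_apply_le a

theorem tendsto_schurMul {ι : Type*} {l : Filter ι} [l.IsCountablyGenerated]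
    {f' : ι → S × T →ᵇ ℂ} {f : S × T →ᵇ ℂ} {K : ℝ} (hK : ∀ i, ‖f' i‖ ≤ K) (hf : ‖f‖ ≤ K)
    (hlim : ∀ z, Tendsto (fun i => f' i z) l (𝓝 (f z))) (a : HSKernel ν) :
    Tendsto (fun i => schurMul hP hQ (f' i) a) l (𝓝 (schurMul hP hQ f a)) := by
  have hb : ∀ f : S × T →ᵇ ℂ, ‖f‖ ≤ K →
      BoundedField ν K (fun g => (rowMul hQ f (P g) : Lp ℂ 2 ν →L[ℂ] Lp ℂ 2 ν)) := fun f hf =>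
    { boundedField_rowMul hP hQ f with
      nonneg := (norm_nonneg f).trans hf
      bound := fun g => ((boundedField_rowMul (ν := ν) hP hQ f).bound g).trans hf }
  exact BoundedField.tendsto_opMul (fun i => hb (f' i) (hK i)) (hb f hf) a
    (Eventually.of_forall fun g => tendsto_rowMul hQ hK hf (fun t => hlim (P g, t)) (a g))

theorem inner_schurMul_left (f : S × T →ᵇ ℂ) (a k : HSKernel ν) :
    inner ℂ (schurMul hP hQ f k) a = inner ℂ k (schurMul hP hQ (star f) a) := by
  rw [L2.inner_def, L2.inner_def]
  refine integral_congr_ae ?_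
  filter_upwards [coeFn_schurMul hP hQ f k, coeFn_schurMul hP hQ (star f) a] with g h1 h2
  rw [h1, h2, L2.inner_def, L2.inner_def]
  refine integral_congr_ae ?_
  filter_upwards [coeFn_rowMul hQ f (P g) (k g), coeFn_rowMul hQ (star f) (P g) (a g)] with h h3 h4
  rw [h3, h4]
  simp [RCLike.inner_apply]
  ring

end Schur

/-! ### Unimodular product symbols -/

section Unimodular

variable {X : Type*} [MeasurableSpace X] {ν : Measure X}

/-- Multiplication by a unimodular function as an isometry of `L₂(ν)`. -/
def mulIsometry {c : X → ℂ} (hc : AEStronglyMeasurable c ν) (h1 : ∀ x, ‖c x‖ = 1) :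
    Lp ℂ 2 ν →ₗᵢ[ℂ] Lp ℂ 2 ν where
  toLinearMap := (boundedField_smul (F := ℂ) hc zero_le_one (fun x => (h1 x).le)).opMul
  norm_map' v := by
    rw [ContinuousLinearMap.coe_coe, Lp.norm_def, Lp.norm_def]
    congr 1
    refine eLpNorm_congr_norm_ae ?_
    filter_upwards [(boundedField_smul (F := ℂ) hc zero_le_one (fun x => (h1 x).le)).coeFn_opMul v]
      with x hx
    rw [hx]
    simp [h1]

theorem coeFn_mulIsometry {c : X → ℂ} (hc : AEStronglyMeasurable c ν) (h1 : ∀ x, ‖c x‖ = 1)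
    (v : Lp ℂ 2 ν) : mulIsometry hc h1 v =ᵐ[ν] fun x => c x * v x := by
  filter_upwards [(boundedField_smul (F := ℂ) hc zero_le_one (fun x => (h1 x).le)).coeFn_opMul v]
    with x hx
  exact hx

variable {S T : Type*} [TopologicalSpace S] [TopologicalSpace T] [MeasurableSpace T] [BorelSpace T]
  {P : X → S} {Q : X → T} [SecondCountableTopology S] [TopologicalSpace.PseudoMetrizableSpace S]
  [MeasurableSpace S] [BorelSpace S] (hP : Measurable P) (hQ : Measurable Q)

/-- A symbol `c₁(g) c₂(h)` multiplies the operator on the left and right by diagonal unitaries; the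
left one moves across the inner product as its conjugate. -/
theorem inner_kernelOp_schurMul {f : S × T →ᵇ ℂ} {c₁ c₂ : X → ℂ}
    (hc₁ : AEStronglyMeasurable (fun x => star (c₁ x)) ν) (h₁ : ∀ x, ‖star (c₁ x)‖ = 1)
    (hc₂ : AEStronglyMeasurable c₂ ν) (h₂ : ∀ x, ‖c₂ x‖ = 1)
    (hf : ∀ g h, f (P g, Q h) = c₁ g * c₂ h) (a : HSKernel ν) (x y : Lp ℂ 2 ν) :
    inner ℂ y (kernelOp (schurMul hP hQ f a) x) =
      inner ℂ (mulIsometry hc₁ h₁ y) (kernelOp a (mulIsometry hc₂ h₂ x)) := by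
  rw [L2.inner_def, L2.inner_def]
  refine integral_congr_ae ?_
  filter_upwards [kernelOp_apply (schurMul hP hQ f a) x, kernelOp_apply a (mulIsometry hc₂ h₂ x),
    coeFn_schurMul hP hQ f a, coeFn_mulIsometry hc₁ h₁ y] with g e1 e2 e3 e4
  have : ∫ h, schurMul hP hQ f a g h * x h ∂ν = c₁ g * ∫ h, a g h * mulIsometry hc₂ h₂ x h ∂ν := by
    rw [e3, ← integral_const_mul]
    refine integral_congr_ae ?_
    filter_upwards [coeFn_rowMul hQ f (P g) (a g), coeFn_mulIsometry hc₂ h₂ x] with h e5 e6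
    rw [e5, e6, hf]
    ring
  rw [e1, e2, e4, this]
  simp only [RCLike.inner_apply, map_mul, RCLike.star_def, RCLike.conj_conj]
  ring

theorem matrixSchattenNorm_smul_schurMul_le {p : ℝ≥0∞} [Fact (1 ≤ p)] {f : S × T →ᵇ ℂ}
    {c₁ c₂ : X → ℂ} (hc₁ : AEStronglyMeasurable c₁ ν) (h₁ : ∀ x, ‖c₁ x‖ = 1)
    (hc₂ : AEStronglyMeasurable c₂ ν) (h₂ : ∀ x, ‖c₂ x‖ = 1)
    (hf : ∀ g h, f (P g, Q h) = c₁ g * c₂ h) (c : ℂ) {n : ℕ}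
    (a : Matrix (Fin n) (Fin n) (HSKernel ν)) :
    matrixSchattenNorm p (a.map fun k => c • schurMul hP hQ f k) ≤
      ‖c‖ₑ * matrixSchattenNorm p a := by
  have hc₁' : AEStronglyMeasurable (fun x => star (c₁ x)) ν :=
    continuous_star.comp_aestronglyMeasurable hc₁
  have h₁' : ∀ x, ‖star (c₁ x)‖ = 1 := fun x => by rw [norm_star, h₁]
  refine schattenNorm_le_of_inner_eq (isCompactOperator_blockOp_kernelOp a)
    (isCompactOperator_blockOp_kernelOp _) (piLpIsometry n (mulIsometry hc₁' h₁'))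
    (piLpIsometry n (mulIsometry hc₂ h₂)) c fun x y => ?_
  rw [inner_blockOp, inner_blockOp, Finset.mul_sum]
  refine Finset.sum_congr rfl fun i _ => ?_
  rw [Finset.mul_sum]
  refine Finset.sum_congr rfl fun j _ => ?_
  simp only [Matrix.map_apply]
  rw [← kernelOpL_apply, map_smul, _root_.smul_apply, inner_smul_right, kernelOpL_apply,
    inner_kernelOp_schurMul hP hQ hc₁' h₁' hc₂ h₂ hf]
  rfl

end Unimodular

/-! ### Averages of Schur multipliers -/

section Average

theorem integral_smul_comp_simpleFunc {Y Z : Type*} [MeasurableSpace Y] {lam : Measure Y}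
    {E : Type*} [NormedAddCommGroup E] [NormedSpace ℂ E] [CompleteSpace E] {w : Y → ℂ}
    (hw : Integrable w lam) (s : SimpleFunc Y Z) (g : Z → E) :
    ∫ y, w y • g (s y) ∂lam = ∑ c ∈ s.range, (∫ y in s ⁻¹' {c}, w y ∂lam) • g c := by
  classical
  have h1 : ∀ y, w y • g (s y) = ∑ c ∈ s.range, (s ⁻¹' {c}).indicator w y • g c := fun y => by
    rw [Finset.sum_eq_single_of_mem (s y) (s.mem_range_self y)]
    · simp
    · intro c _ hc
      have hy : y ∉ s ⁻¹' {c} := fun h => hc (Eq.symm h)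
      rw [Set.indicator_of_notMem hy, zero_smul]
  simp_rw [h1]
  rw [integral_finsetSum _ fun c _ =>
    (hw.indicator (s.measurableSet_preimage {c})).smul_const (g c)]
  refine Finset.sum_congr rfl fun c _ => ?_
  rw [integral_smul_const, integral_indicator (s.measurableSet_preimage {c})]

variable {X : Type*} [MeasurableSpace X] {ν : Measure X}
  {S T : Type*} [TopologicalSpace S] [TopologicalSpace T] [MeasurableSpace T] [BorelSpace T]
  {P : X → S} {Q : X → T} [SecondCountableTopology S] [TopologicalSpace.PseudoMetrizableSpace S]
  [MeasurableSpace S] [BorelSpace S] (hP : Measurable P) (hQ : Measurable Q)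
  {Y : Type*} [PseudoMetricSpace Y]

theorem continuous_schurMul_apply {f : Y → S × T →ᵇ ℂ} {K : ℝ}
    (hK : ∀ y, ‖f y‖ ≤ K) (hf : ∀ z, Continuous fun y => f y z) (a : HSKernel ν) :
    Continuous fun y => schurMul hP hQ (f y) a :=
  continuous_iff_continuousAt.2 fun y =>
    tendsto_schurMul hP hQ hK (hK y) (fun z => (hf z).tendsto y) a

variable [SecondCountableTopology Y] [MeasurableSpace Y] [BorelSpace Y] {lam : Measure Y}

theorem integrable_smul_schurMul {w : Y → ℂ} (hw : Integrable w lam)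
    {f : Y → S × T →ᵇ ℂ} {K : ℝ} (hK : ∀ y, ‖f y‖ ≤ K) (hf : ∀ z, Continuous fun y => f y z)
    (a : HSKernel ν) : Integrable (fun y => w y • schurMul hP hQ (f y) a) lam :=
  hw.smul_bdd (K * ‖a‖) (continuous_schurMul_apply hP hQ hK hf a).aestronglyMeasurable
    (Eventually.of_forall fun y => (norm_schurMul_apply_le hP hQ (f y) a).trans
      (mul_le_mul_of_nonneg_right (hK y) (norm_nonneg a)))

/-- Approximating the parameter `y` by simple functions reduces the exchange of integral and
multiplier to finite linearity. This avoids Fubini, as `ν` need not be σ-finite. -/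
theorem integral_smul_schurMul [Nonempty Y] {w : Y → ℂ} (hw : Integrable w lam)
    {f : Y → S × T →ᵇ ℂ} {K : ℝ} (hK : ∀ y, ‖f y‖ ≤ K) (hf : ∀ z, Continuous fun y => f y z)
    {F : S × T →ᵇ ℂ} (hF : ∀ z, F z = ∫ y, w y * f y z ∂lam) (a : HSKernel ν) :
    ∫ y, w y • schurMul hP hQ (f y) a ∂lam = schurMul hP hQ F a := by
  classical
  obtain ⟨y₀⟩ := ‹Nonempty Y›
  let s : ℕ → SimpleFunc Y Y := SimpleFunc.approxOn id measurable_id Set.univ y₀ (Set.mem_univ _)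
  have hs : ∀ y, Tendsto (fun n => s n y) atTop (𝓝 y) := fun y =>
    SimpleFunc.tendsto_approxOn measurable_id (Set.mem_univ _) (by simp)
  let F' : ℕ → S × T →ᵇ ℂ := fun n => ∑ c ∈ (s n).range, (∫ y in s n ⁻¹' {c}, w y ∂lam) • f c
  have hF' : ∀ n z, F' n z = ∫ y, w y * f (s n y) z ∂lam := fun n z => by
    have := integral_smul_comp_simpleFunc hw (s n) (fun c => f c z)
    simp only [smul_eq_mul] at this
    rw [this]
    simp [F']
  have hbd : ∀ (u : Y → Y) z, ‖∫ y, w y * f (u y) z ∂lam‖ ≤ (∫ y, ‖w y‖ ∂lam) * K := fun u z => by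
    rw [← integral_mul_const]
    refine norm_integral_le_of_norm_le (hw.norm.mul_const K) (Eventually.of_forall fun y => ?_)
    rw [norm_mul]
    exact mul_le_mul_of_nonneg_left (((f (u y)).norm_coe_le_norm z).trans (hK _)) (norm_nonneg _)
  have hK0 : 0 ≤ K := (norm_nonneg _).trans (hK y₀)
  have hC : 0 ≤ (∫ y, ‖w y‖ ∂lam) * K := mul_nonneg (integral_nonneg fun _ => norm_nonneg _) hK0
  have hlim1 : Tendsto (fun n => schurMul hP hQ (F' n) a) atTop (𝓝 (schurMul hP hQ F a)) := by
    refine tendsto_schurMul hP hQ (K := (∫ y, ‖w y‖ ∂lam) * K)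
      (fun n => (norm_le hC).2 fun z => by rw [hF']; exact hbd (s n) z)
      ((norm_le hC).2 fun z => by rw [hF]; exact hbd id z) (fun z => ?_) a
    simp_rw [hF', hF]
    refine tendsto_integral_of_dominated_convergence (fun y => ‖w y‖ * K) (fun n => ?_)
      (hw.norm.mul_const K) (fun n => Eventually.of_forall fun y => ?_)
      (Eventually.of_forall fun y => ?_)
    · exact hw.1.mul ((s n).map fun c => f c z).aestronglyMeasurable
    · rw [norm_mul]
      exact mul_le_mul_of_nonneg_left (((f (s n y)).norm_coe_le_norm z).trans (hK _))
        (norm_nonneg _)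
    · exact (((hf z).tendsto y).comp (hs y)).const_mul (w y)
  have hlim2 : Tendsto (fun n => schurMul hP hQ (F' n) a) atTop
      (𝓝 (∫ y, w y • schurMul hP hQ (f y) a ∂lam)) := by
    have h1 : ∀ n, schurMul hP hQ (F' n) a = ∫ y, w y • schurMul hP hQ (f (s n y)) a ∂lam :=
      fun n => by
        refine Eq.trans ?_
          (integral_smul_comp_simpleFunc hw (s n) fun c => schurMul hP hQ (f c) a).symm
        let L : (S × T →ᵇ ℂ) →ₗ[ℂ] HSKernel ν :=
          { toFun := fun f => schurMul hP hQ f a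
            map_add' := fun f f' => schurMul_add hP hQ f f' a
            map_smul' := fun c f => schurMul_smul hP hQ c f a }
        change L (F' n) = ∑ c ∈ (s n).range, (∫ y in s n ⁻¹' {c}, w y ∂lam) • L (f c)
        simp only [F', map_sum, map_smul]
    simp_rw [h1]
    refine tendsto_integral_of_dominated_convergence (fun y => ‖w y‖ * (K * ‖a‖)) (fun n => ?_)
      (hw.norm.mul_const _) (fun n => Eventually.of_forall fun y => ?_)
      (Eventually.of_forall fun y => ?_)
    · exact hw.1.smul ((s n).map fun c => schurMul hP hQ (f c) a).aestronglyMeasurable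
    · rw [norm_smul]
      exact mul_le_mul_of_nonneg_left ((norm_schurMul_apply_le hP hQ _ a).trans
        (mul_le_mul_of_nonneg_right (hK _) (norm_nonneg a))) (norm_nonneg _)
    · exact (((continuous_schurMul_apply hP hQ hK hf a).tendsto y).comp (hs y)).const_smul (w y)
  exact tendsto_nhds_unique hlim2 hlim1

end Average

/-! ### The two Fourier transforms agree on `L₁ ∩ L₂` -/

section FourierL1L2

variable {V : Type*} [NormedAddCommGroup V] [InnerProductSpace ℝ V] [FiniteDimensional ℝ V]
  [MeasurableSpace V] [BorelSpace V]
  {E : Type*} [NormedAddCommGroup E] [InnerProductSpace ℂ E] [CompleteSpace E]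

/-- Both transforms have the same pairing with smooth compactly supported functions: one through
tempered distributions, the other through the self-adjointness of the Fourier integral. -/
theorem fourier_toLp_ae_eq {f : V → E} (h1 : Integrable f) (h2 : MemLp f 2) :
    (𝓕 (h2.toLp f) : Lp E 2 (volume : Measure V)) =ᵐ[volume] 𝓕 f := by
  have hcont : Continuous (𝓕 f) :=
    VectorFourier.fourierIntegral_continuous Real.continuous_fourierChar
      (by exact continuous_inner) h1
  refine ae_eq_of_integral_contDiff_smul_eq
    ((Lp.memLp _).locallyIntegrable (by norm_num)) hcont.locallyIntegrable fun g hg hgs => ?_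
  let G : 𝓢(V, ℂ) := (hgs.comp_left (g := fun r : ℝ => (r : ℂ)) Complex.ofReal_zero).toSchwartzMap
    (Complex.ofRealCLM.contDiff.comp hg)
  have hG : ∀ x, G x = (g x : ℂ) := fun x => rfl
  have e1 := congrArg (fun D => D G) (Lp.fourier_toTemperedDistribution_eq (h2.toLp f))
  simp only [TemperedDistribution.fourier_apply, Lp.toTemperedDistribution_apply] at e1
  have e2 : ∫ x, (𝓕 G) x • f x = ∫ x, G x • 𝓕 f x := by
    have := VectorFourier.integral_fourierIntegral_smul_eq_flip (L := innerₗ V)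
      Real.continuous_fourierChar continuous_inner (μ := volume) (ν := volume) G.integrable h1
    rwa [flip_innerₗ] at this
  calc ∫ x, g x • (𝓕 (h2.toLp f) : Lp E 2 (volume : Measure V)) x
      = ∫ x, G x • (𝓕 (h2.toLp f) : Lp E 2 (volume : Measure V)) x := by
        simp [hG]
    _ = ∫ x, (𝓕 G) x • f x := by
        rw [← e1]
        refine integral_congr_ae ?_
        filter_upwards [h2.coeFn_toLp] with x hx
        rw [hx]
    _ = ∫ x, g x • 𝓕 f x := by
        rw [e2]; simp [hG]

end FourierL1L2

/-! ### Modulated lifts of kernels and their Fourier transforms -/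

section Twist

variable {X : Type*} [MeasurableSpace X] {ν : Measure X} {d : ℕ}
  {S T : Type*} [TopologicalSpace S] [TopologicalSpace T] [MeasurableSpace T] [BorelSpace T]
  {P : X → S} {Q : X → T} [SecondCountableTopology S] [TopologicalSpace.PseudoMetrizableSpace S]
  [MeasurableSpace S] [BorelSpace S] (hP : Measurable P) (hQ : Measurable Q)

/-- The character `z ↦ exp(2πi⟨x, b z⟩)`. -/
def charBCF {Z : Type*} [TopologicalSpace Z] (b : C(Z, EuclideanSpace ℝ (Fin d)))
    (x : EuclideanSpace ℝ (Fin d)) : Z →ᵇ ℂ :=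
  ofNormedAddCommGroup (fun z => (Real.fourierChar (inner ℝ x (b z)) : ℂ)) (by fun_prop) 1
    (fun z => (Circle.norm_coe _).le)

theorem charBCF_apply {Z : Type*} [TopologicalSpace Z] (b : C(Z, EuclideanSpace ℝ (Fin d)))
    (x : EuclideanSpace ℝ (Fin d)) (z : Z) :
    charBCF b x z = (Real.fourierChar (inner ℝ x (b z)) : ℂ) := rfl

theorem norm_charBCF_le {Z : Type*} [TopologicalSpace Z] (b : C(Z, EuclideanSpace ℝ (Fin d)))
    (x : EuclideanSpace ℝ (Fin d)) : ‖charBCF b x‖ ≤ 1 :=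
  (norm_le zero_le_one).2 fun z => by
    rw [charBCF_apply, Circle.norm_coe]

theorem continuous_charBCF_apply {Z : Type*} [TopologicalSpace Z]
    (b : C(Z, EuclideanSpace ℝ (Fin d))) (z : Z) : Continuous fun x => charBCF b x z := by
  simp only [charBCF_apply]
  fun_prop

theorem continuous_schurMul_charBCF (b : C(S × T, EuclideanSpace ℝ (Fin d))) (a : HSKernel ν) :
    Continuous fun x => schurMul hP hQ (charBCF b x) a :=
  continuous_schurMul_apply hP hQ (norm_charBCF_le b) (continuous_charBCF_apply b) a

theorem norm_schurMul_charBCF_le (b : C(S × T, EuclideanSpace ℝ (Fin d)))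
    (x : EuclideanSpace ℝ (Fin d)) (a : HSKernel ν) : ‖schurMul hP hQ (charBCF b x) a‖ ≤ ‖a‖ :=
  (norm_schurMul_apply_le hP hQ _ a).trans
    (mul_le_of_le_one_left (norm_nonneg a) (norm_charBCF_le b x))

theorem norm_smul_schurMul_charBCF_le (b : C(S × T, EuclideanSpace ℝ (Fin d)))
    (φ : 𝓢(EuclideanSpace ℝ (Fin d), ℂ)) (x : EuclideanSpace ℝ (Fin d)) (a : HSKernel ν) :
    ‖φ x • schurMul hP hQ (charBCF b x) a‖ ≤ ‖a‖ * ‖φ x‖ := by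
  rw [norm_smul, mul_comm]
  exact mul_le_mul_of_nonneg_right (norm_schurMul_charBCF_le hP hQ b x a) (norm_nonneg _)

theorem memLp_twist (b : C(S × T, EuclideanSpace ℝ (Fin d)))
    (φ : 𝓢(EuclideanSpace ℝ (Fin d), ℂ)) (a : HSKernel ν) :
    MemLp (fun x => φ x • schurMul hP hQ (charBCF b x) a) 2 volume :=
  (φ.memLp 2 volume).of_le_mul
    (φ.continuous.smul (continuous_schurMul_charBCF hP hQ b a)).aestronglyMeasurable
    (Eventually.of_forall fun x => norm_smul_schurMul_charBCF_le hP hQ b φ x a)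

/-- The kernel-valued function `x ↦ φ(x) (exp(2πi⟨x, b_{gh}⟩) a_{gh})`. -/
def twist (b : C(S × T, EuclideanSpace ℝ (Fin d))) (φ : 𝓢(EuclideanSpace ℝ (Fin d), ℂ)) :
    HSKernel ν →L[ℂ] L2HS ν d :=
  LinearMap.mkContinuous
    { toFun := fun a => (memLp_twist hP hQ b φ a).toLp _
      map_add' := fun a a' => by
        rw [← MemLp.toLp_add]
        refine MemLp.toLp_congr _ _ (Eventually.of_forall fun x => ?_)
        simp only [map_add, smul_add, Pi.add_apply]
      map_smul' := fun c a => by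
        rw [RingHom.id_apply, ← MemLp.toLp_const_smul]
        refine MemLp.toLp_congr _ _ (Eventually.of_forall fun x => ?_)
        simp only [map_smul, Pi.smul_apply, smul_comm c] }
    ‖φ.toLp 2 volume‖ (fun a => by
      rw [mul_comm]
      refine Lp.norm_le_mul_norm_of_ae_le_mul ?_
      filter_upwards [(memLp_twist hP hQ b φ a).coeFn_toLp, φ.coeFn_toLp 2 volume] with x h1 h2
      simp only [LinearMap.coe_mk, AddHom.coe_mk, h1, h2]
      exact norm_smul_schurMul_charBCF_le hP hQ b φ x a)

theorem coeFn_twist (b : C(S × T, EuclideanSpace ℝ (Fin d)))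
    (φ : 𝓢(EuclideanSpace ℝ (Fin d), ℂ)) (a : HSKernel ν) :
    twist hP hQ b φ a =ᵐ[volume] fun x => φ x • schurMul hP hQ (charBCF b x) a :=
  (memLp_twist hP hQ b φ a).coeFn_toLp

/-- The symbol `z ↦ φ(ξ - b z)`. -/
def shiftBCF {Z : Type*} [TopologicalSpace Z] (b : C(Z, EuclideanSpace ℝ (Fin d)))
    (φ : 𝓢(EuclideanSpace ℝ (Fin d), ℂ)) (ξ : EuclideanSpace ℝ (Fin d)) : Z →ᵇ ℂ :=
  φ.toBoundedContinuousFunction.compContinuous ⟨fun z => ξ - b z, by fun_prop⟩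

theorem shiftBCF_apply {Z : Type*} [TopologicalSpace Z] (b : C(Z, EuclideanSpace ℝ (Fin d)))
    (φ : 𝓢(EuclideanSpace ℝ (Fin d), ℂ)) (ξ : EuclideanSpace ℝ (Fin d)) (z : Z) :
    shiftBCF b φ ξ z = φ (ξ - b z) := rfl

/-- Modulation becomes translation: entrywise the transform is `φ̂(ξ - b_{gh}) a_{gh}`. Averaging
the symbols under the integral makes this an identity of kernels. -/
theorem fourier_twist (b : C(S × T, EuclideanSpace ℝ (Fin d)))
    (φ : 𝓢(EuclideanSpace ℝ (Fin d), ℂ)) (a : HSKernel ν) :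
    (𝓕 (twist hP hQ b φ a) : L2HS ν d) =ᵐ[volume]
      fun ξ => schurMul hP hQ (shiftBCF b (𝓕 φ) ξ) a := by
  have hint : Integrable (fun x => φ x • schurMul hP hQ (charBCF b x) a) :=
    integrable_smul_schurMul hP hQ φ.integrable (norm_charBCF_le b) (continuous_charBCF_apply b) a
  filter_upwards [fourier_toLp_ae_eq hint (memLp_twist hP hQ b φ a)] with ξ hξ
  refine hξ.trans ?_
  rw [Real.fourier_eq]
  have hw : Integrable (fun x => Real.fourierChar (-inner ℝ x ξ) • φ x) :=
    (Real.fourierIntegral_convergent_iff ξ).2 φ.integrable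
  have key := integral_smul_schurMul hP hQ hw (norm_charBCF_le b) (continuous_charBCF_apply b)
    (F := shiftBCF b (𝓕 φ) ξ) (fun z => by
      rw [shiftBCF_apply, fourier_coe, Real.fourier_eq]
      refine integral_congr_ae (Eventually.of_forall fun x => ?_)
      simp only [charBCF_apply, Circle.smul_def, smul_eq_mul]
      rw [inner_sub_right, neg_sub, sub_eq_add_neg, AddChar.map_add_eq_mul, Circle.coe_mul]
      ring) a
  rw [← key]
  refine integral_congr_ae (Eventually.of_forall fun x => ?_)
  simp only [smul_assoc]

end Twist

/-! ### Pairing a multiplier image with a lift -/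

section Translation

variable {X : Type*} [MeasurableSpace X] {ν : Measure X} {d : ℕ}
  {S T : Type*} [TopologicalSpace S] [TopologicalSpace T]

/-- The frequency slice `z ↦ M(ξ, z.1)` of a multiplier symbol. -/
def sliceBCF (T : Type*) [TopologicalSpace T] (M : EuclideanSpace ℝ (Fin d) × S →ᵇ ℂ)
    (ξ : EuclideanSpace ℝ (Fin d)) : S × T →ᵇ ℂ :=
  M.compContinuous ⟨fun z => (ξ, z.1), by fun_prop⟩

/-- The translated frequency slice `z ↦ M(ξ + b z, z.1)`. -/
def transBCF (b : C(S × T, EuclideanSpace ℝ (Fin d))) (M : EuclideanSpace ℝ (Fin d) × S →ᵇ ℂ)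
    (ξ : EuclideanSpace ℝ (Fin d)) : S × T →ᵇ ℂ :=
  M.compContinuous ⟨fun z => (ξ + b z, z.1), by fun_prop⟩

theorem transBCF_apply (b : C(S × T, EuclideanSpace ℝ (Fin d)))
    (M : EuclideanSpace ℝ (Fin d) × S →ᵇ ℂ) (ξ : EuclideanSpace ℝ (Fin d)) (z : S × T) :
    transBCF b M ξ z = M (ξ + b z, z.1) := rfl

theorem norm_transBCF_le (b : C(S × T, EuclideanSpace ℝ (Fin d)))
    (M : EuclideanSpace ℝ (Fin d) × S →ᵇ ℂ) (ξ : EuclideanSpace ℝ (Fin d)) :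
    ‖transBCF b M ξ‖ ≤ ‖M‖ :=
  (norm_le (norm_nonneg M)).2 fun _ => M.norm_coe_le_norm _

theorem continuous_transBCF_apply (b : C(S × T, EuclideanSpace ℝ (Fin d)))
    (M : EuclideanSpace ℝ (Fin d) × S →ᵇ ℂ) (z : S × T) :
    Continuous fun ξ => transBCF b M ξ z :=
  M.continuous.comp (by fun_prop : Continuous fun ξ => (ξ + b z, z.1))

theorem exists_decay_bound (φ : 𝓢(EuclideanSpace ℝ (Fin d), ℂ)) (k : ℕ) :
    ∃ C : ℝ, 0 ≤ C ∧ ∀ x, (1 + ‖x‖) ^ k * ‖φ x‖ ≤ C := by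
  refine ⟨2 ^ k * (Finset.Iic (k, 0)).sup (fun m => SchwartzMap.seminorm ℝ m.1 m.2) φ,
    by positivity, fun x => ?_⟩
  have := one_add_le_sup_seminorm_apply (𝕜 := ℝ) (m := (k, 0)) (le_refl k) (le_refl 0) φ x
  simpa using this

theorem integrable_norm_sq (φ : 𝓢(EuclideanSpace ℝ (Fin d), ℂ)) :
    Integrable fun ξ => ((‖φ ξ‖ ^ 2 : ℝ) : ℂ) :=
  ((φ.memLp 2 volume).integrable_norm_pow (by norm_num)).ofReal

theorem exists_average_transBCF [FirstCountableTopology S] [FirstCountableTopology T]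
    (b : C(S × T, EuclideanSpace ℝ (Fin d)))
    (φ : 𝓢(EuclideanSpace ℝ (Fin d), ℂ)) (M : EuclideanSpace ℝ (Fin d) × S →ᵇ ℂ) :
    ∃ G : S × T →ᵇ ℂ, ∀ z, G z = ∫ ξ, ((‖φ ξ‖ ^ 2 : ℝ) : ℂ) * transBCF b M ξ z := by
  have hle : ∀ ξ z, ‖((‖φ ξ‖ ^ 2 : ℝ) : ℂ) * transBCF b M ξ z‖ ≤
      ‖((‖φ ξ‖ ^ 2 : ℝ) : ℂ)‖ * ‖M‖ := fun ξ z => by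
    rw [norm_mul]
    exact mul_le_mul_of_nonneg_left (M.norm_coe_le_norm _) (norm_nonneg _)
  have hi := (integrable_norm_sq φ).norm.mul_const ‖M‖
  refine ⟨ofNormedAddCommGroup _ (continuous_of_dominated (fun z => ?_)
    (fun z => Eventually.of_forall fun ξ => hle ξ z) hi (Eventually.of_forall fun ξ => ?_))
    (∫ ξ, ‖((‖φ ξ‖ ^ 2 : ℝ) : ℂ)‖ * ‖M‖) (fun z => ?_), fun z => rfl⟩
  · exact (integrable_norm_sq φ).1.mul (continuous_transBCF_apply b M z).aestronglyMeasurable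
  · exact continuous_const.mul (transBCF b M ξ).continuous
  · exact norm_integral_le_of_norm_le hi (Eventually.of_forall fun ξ => hle ξ z)

variable [MeasurableSpace T] [BorelSpace T]
  {P : X → S} {Q : X → T} [SecondCountableTopology S] [TopologicalSpace.PseudoMetrizableSpace S]
  [MeasurableSpace S] [BorelSpace S] (hP : Measurable P) (hQ : Measurable Q)

theorem fourier_eq_of_isTwistedMultiplierImage (b : C(S × T, EuclideanSpace ℝ (Fin d)))
    (φ : 𝓢(EuclideanSpace ℝ (Fin d), ℂ)) (a : HSKernel ν) (M : EuclideanSpace ℝ (Fin d) × S →ᵇ ℂ)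
    {y : L2HS ν d}
    (hy : IsTwistedMultiplierImage (fun g ξ => M (ξ, P g)) (twist hP hQ b φ a) y) :
    (𝓕 y : L2HS ν d) =ᵐ[volume] fun ξ =>
      schurMul hP hQ (sliceBCF T M ξ) (schurMul hP hQ (shiftBCF b (𝓕 φ) ξ) a) := by
  filter_upwards [hy, fourier_twist hP hQ b φ a] with ξ h1 h2
  rw [h2] at h1
  exact h1.eq_schurMul hP hQ (f := sliceBCF T M ξ)

theorem inner_twist_eq_integral (b : C(S × T, EuclideanSpace ℝ (Fin d)))
    (φ : 𝓢(EuclideanSpace ℝ (Fin d), ℂ)) (a : HSKernel ν) (M : EuclideanSpace ℝ (Fin d) × S →ᵇ ℂ)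
    {y : L2HS ν d}
    (hy : IsTwistedMultiplierImage (fun g ξ => M (ξ, P g)) (twist hP hQ b φ a) y)
    (k : HSKernel ν) :
    inner ℂ (twist hP hQ b φ k) y = ∫ ξ, inner ℂ k (schurMul hP hQ
      (star (shiftBCF b (𝓕 φ) ξ) * sliceBCF T M ξ * shiftBCF b (𝓕 φ) ξ) a) := by
  rw [← Lp.inner_fourier_eq, L2.inner_def]
  refine integral_congr_ae ?_
  filter_upwards [fourier_twist hP hQ b φ k,
    fourier_eq_of_isTwistedMultiplierImage hP hQ b φ a M hy] with ξ h1 h2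
  rw [h1, h2, inner_schurMul_left, schurMul_mul, schurMul_mul]

variable [FirstCountableTopology T]

/-- The substitution `ξ ↦ ξ - b z` is made separately for each entry `z`, so it must be done at the
level of symbols. The cutoff `χ` keeps `b` bounded, which gives a decay in `ξ` uniform in `z`. -/
theorem inner_twist_schurMul_of_bounded (b : C(S × T, EuclideanSpace ℝ (Fin d)))
    (φ : 𝓢(EuclideanSpace ℝ (Fin d), ℂ)) (a : HSKernel ν) (M : EuclideanSpace ℝ (Fin d) × S →ᵇ ℂ)
    {y : L2HS ν d}
    (hy : IsTwistedMultiplierImage (fun g ξ => M (ξ, P g)) (twist hP hQ b φ a) y)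
    (k : HSKernel ν) {χ : S × T →ᵇ ℂ} {R : ℝ} (hχ : ∀ z, χ z ≠ 0 → ‖b z‖ ≤ R) :
    inner ℂ (twist hP hQ b φ (schurMul hP hQ χ k)) y =
      inner ℂ (schurMul hP hQ χ k)
        (∫ ξ, ((‖𝓕 φ ξ‖ ^ 2 : ℝ) : ℂ) • schurMul hP hQ (transBCF b M ξ) a) := by
  obtain ⟨G, hG⟩ := exists_average_transBCF b (𝓕 φ) M
  rw [integral_smul_schurMul hP hQ (integrable_norm_sq (𝓕 φ)) (norm_transBCF_le b M)
    (continuous_transBCF_apply b M) hG a, inner_schurMul_left, ← schurMul_mul,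
    inner_twist_eq_integral hP hQ b φ a M hy]
  -- The exponent `d + 1` exceeds the dimension, so the weight `(1 + ‖ξ‖)^{-(d+1)}` is integrable;
  -- its inverse is absorbed into the symbol `F`, bounded by Schwartz decay of one factor `φ̂`.
  obtain ⟨C, hC0, hC⟩ := exists_decay_bound (𝓕 φ) (d + 1)
  have hC' : ∀ x, ‖(𝓕 φ) x‖ ≤ C := fun x =>
    (le_mul_of_one_le_left (norm_nonneg _)
      (one_le_pow₀ (by linarith [norm_nonneg x]))).trans (hC x)
  let w : EuclideanSpace ℝ (Fin d) → ℂ := fun ξ => ((((1 + ‖ξ‖) ^ (d + 1))⁻¹ : ℝ) : ℂ)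
  have hw : Integrable w := by
    have h := (integrable_one_add_norm (E := EuclideanSpace ℝ (Fin d)) (μ := volume)
      (r := ((d + 1 : ℕ) : ℝ)) (by simp)).ofReal (𝕜 := ℂ)
    refine h.congr (Eventually.of_forall fun ξ => ?_)
    simp only [w]
    rw [Real.rpow_neg (by positivity), Real.rpow_natCast]
    rfl
  have hw0 : ∀ ξ : EuclideanSpace ℝ (Fin d), ((1 + ‖ξ‖) ^ (d + 1) : ℝ) ≠ 0 := fun ξ => by positivity
  let F : EuclideanSpace ℝ (Fin d) → S × T →ᵇ ℂ := fun ξ =>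
    (((1 + ‖ξ‖) ^ (d + 1) : ℝ) : ℂ) •
      (star χ * (star (shiftBCF b (𝓕 φ) ξ) * sliceBCF T M ξ * shiftBCF b (𝓕 φ) ξ))
  have hF : ∀ ξ z, F ξ z = (((1 + ‖ξ‖) ^ (d + 1) : ℝ) : ℂ) * (star (χ z) *
      (star ((𝓕 φ) (ξ - b z)) * M (ξ, z.1) * (𝓕 φ) (ξ - b z))) := fun ξ z => rfl
  have hFn : ∀ ξ, ‖F ξ‖ ≤ (1 + |R|) ^ (d + 1) * C * C * ‖χ‖ * ‖M‖ := fun ξ => by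
    refine (norm_le (by positivity)).2 fun z => ?_
    rw [hF]
    by_cases hz : χ z = 0
    · rw [hz, star_zero, zero_mul, mul_zero, norm_zero]
      positivity
    have hb := (hχ z hz).trans (le_abs_self R)
    -- Where `χ z ≠ 0`, shifting by `b z` changes the weight by at most the factor `1 + |R|`.
    have h1 : 1 + ‖ξ‖ ≤ (1 + |R|) * (1 + ‖ξ - b z‖) := by
      have : ‖ξ‖ ≤ ‖ξ - b z‖ + ‖b z‖ := by simpa using norm_add_le (ξ - b z) (b z)
      nlinarith [abs_nonneg R, norm_nonneg (ξ - b z)]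
    have h2 : (1 + ‖ξ‖) ^ (d + 1) * ‖(𝓕 φ) (ξ - b z)‖ ≤ (1 + |R|) ^ (d + 1) * C := by
      calc (1 + ‖ξ‖) ^ (d + 1) * ‖(𝓕 φ) (ξ - b z)‖
          ≤ ((1 + |R|) * (1 + ‖ξ - b z‖)) ^ (d + 1) * ‖(𝓕 φ) (ξ - b z)‖ := by gcongr
        _ = (1 + |R|) ^ (d + 1) * ((1 + ‖ξ - b z‖) ^ (d + 1) * ‖(𝓕 φ) (ξ - b z)‖) := by
            rw [mul_pow]; ring
        _ ≤ _ := by gcongr; exact hC _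
    simp only [norm_mul, norm_star, Complex.norm_real]
    rw [Real.norm_of_nonneg (by positivity)]
    calc (1 + ‖ξ‖) ^ (d + 1) * (‖χ z‖ * (‖(𝓕 φ) (ξ - b z)‖ * ‖M (ξ, z.1)‖ * ‖(𝓕 φ) (ξ - b z)‖))
        = ((1 + ‖ξ‖) ^ (d + 1) * ‖(𝓕 φ) (ξ - b z)‖) * ‖(𝓕 φ) (ξ - b z)‖ * ‖χ z‖ *
            ‖M (ξ, z.1)‖ := by ring
      _ ≤ (1 + |R|) ^ (d + 1) * C * C * ‖χ‖ * ‖M‖ := by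
          gcongr
          · exact hC' _
          · exact χ.norm_coe_le_norm z
          · exact M.norm_coe_le_norm _
  have hFc : ∀ z, Continuous fun ξ => F ξ z := fun z => by
    simp only [hF]
    have h1 : Continuous fun ξ => (𝓕 φ) (ξ - b z) := (𝓕 φ).continuous.comp (by fun_prop)
    have h2 : Continuous fun ξ => M (ξ, z.1) := M.continuous.comp (by fun_prop)
    exact (Complex.continuous_ofReal.comp (by fun_prop)).mul
      (continuous_const.mul ((h1.star.mul h2).mul h1))
  have hGF : ∀ z, (star χ * G) z = ∫ ξ, w ξ * F ξ z := fun z => by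
    have e1 : (star χ * G) z = star (χ z) * G z := rfl
    rw [e1, hG, ← integral_const_mul,
      ← integral_sub_right_eq_self (fun ξ => star (χ z) * (((‖𝓕 φ ξ‖ ^ 2 : ℝ) : ℂ) *
        transBCF b M ξ z)) (b z)]
    refine integral_congr_ae (Eventually.of_forall fun ξ => ?_)
    simp only [hF, w, transBCF_apply, sub_add_cancel]
    rw [← mul_assoc (((((1 + ‖ξ‖) ^ (d + 1))⁻¹ : ℝ)) : ℂ), ← Complex.ofReal_mul,
      inv_mul_cancel₀ (hw0 ξ), Complex.ofReal_one, one_mul, Complex.ofReal_pow,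
      ← Complex.conj_mul']
    simp only [RCLike.star_def]
    ring
  rw [← integral_smul_schurMul hP hQ hw hFn hFc hGF a,
    ← integral_inner (integrable_smul_schurMul hP hQ hw hFn hFc a)]
  refine integral_congr_ae (Eventually.of_forall fun ξ => ?_)
  simp only [F, w]
  rw [inner_schurMul_left, ← schurMul_mul, schurMul_smul, smul_smul, ← Complex.ofReal_mul,
    inv_mul_cancel₀ (hw0 ξ), Complex.ofReal_one, one_smul]

/-- The cutoffs `χ n`, equal to `1` for `‖b z‖ ≤ n` and to `0` for `‖b z‖ ≥ n + 1`, are removed by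
continuity in `k`. -/
theorem inner_twist (b : C(S × T, EuclideanSpace ℝ (Fin d)))
    (φ : 𝓢(EuclideanSpace ℝ (Fin d), ℂ)) (a : HSKernel ν) (M : EuclideanSpace ℝ (Fin d) × S →ᵇ ℂ)
    {y : L2HS ν d}
    (hy : IsTwistedMultiplierImage (fun g ξ => M (ξ, P g)) (twist hP hQ b φ a) y)
    (k : HSKernel ν) :
    inner ℂ (twist hP hQ b φ k) y =
      inner ℂ k (∫ ξ, ((‖𝓕 φ ξ‖ ^ 2 : ℝ) : ℂ) • schurMul hP hQ (transBCF b M ξ) a) := by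
  let χ : ℕ → S × T →ᵇ ℂ := fun n => ofNormedAddCommGroup
    (fun z => ((max 0 (min 1 (n + 1 - ‖b z‖)) : ℝ) : ℂ)) (by fun_prop) 1 (fun z => by
      rw [Complex.norm_real, Real.norm_of_nonneg (le_max_left _ _)]
      exact max_le zero_le_one (min_le_left _ _))
  have hχ : ∀ n z, χ n z ≠ 0 → ‖b z‖ ≤ n + 1 := fun n z h => by
    by_contra! h'
    refine h ?_
    have : min 1 ((n : ℝ) + 1 - ‖b z‖) ≤ 0 := (min_le_right _ _).trans (by linarith)
    change ((max 0 (min 1 ((n : ℝ) + 1 - ‖b z‖)) : ℝ) : ℂ) = 0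
    rw [max_eq_left this, Complex.ofReal_zero]
  have hlim : Tendsto (fun n => schurMul hP hQ (χ n) k) atTop (𝓝 k) := by
    have := tendsto_schurMul hP hQ (l := atTop) (f' := χ) (f := 1) (K := 1) (fun n => ?_) ?_
      (fun z => ?_) k
    · rwa [schurMul_one] at this
    · exact norm_ofNormedAddCommGroup_le _ zero_le_one _
    · exact (norm_le zero_le_one).2 fun z => by simp
    · refine tendsto_const_nhds.congr' ?_
      filter_upwards [eventually_ge_atTop ⌈‖b z‖⌉₊] with n hn
      have h1 : ‖b z‖ ≤ n := (Nat.le_ceil _).trans (by exact_mod_cast hn)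
      change (1 : ℂ) = ((max 0 (min 1 ((n : ℝ) + 1 - ‖b z‖)) : ℝ) : ℂ)
      rw [min_eq_left (by linarith), max_eq_right zero_le_one, Complex.ofReal_one]
  refine tendsto_nhds_unique (f := fun n => inner ℂ (twist hP hQ b φ (schurMul hP hQ (χ n) k)) y)
    (l := atTop) ?_ ?_
  · exact (((twist hP hQ b φ).continuous.tendsto k).comp hlim).inner tendsto_const_nhds
  · simp_rw [inner_twist_schurMul_of_bounded hP hQ b φ a M hy k (hχ _)]
    exact hlim.inner tendsto_const_nhds

end Translation

/-! ### Representing norming functionals by kernels -/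

section Duality

variable {X : Type*} [MeasurableSpace X] {ν : Measure X}

/-- Each matrix entry enters through a continuous functional on the Hilbert space of kernels, so
Riesz representation replaces Schatten duality. -/
theorem exists_inner_eq_dual_pairingVec {p : ℝ≥0∞} [Fact (1 ≤ p)] {n r : ℕ}
    (e f : Fin r → PiLp 2 (fun _ : Fin n => Lp ℂ 2 ν))
    (θ : PiLp p (fun _ : Fin r => ℂ) →L[ℂ] ℂ) :
    ∃ k : Matrix (Fin n) (Fin n) (HSKernel ν), ∀ c : Matrix (Fin n) (Fin n) (HSKernel ν),
      θ (pairingVec p e f (blockOp (c.map kernelOp))) = ∑ i, ∑ j, inner ℂ (k i j) (c i j) := by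
  let κ : Fin n → Fin n → HSKernel ν →L[ℂ] ℂ := fun i j =>
    θ ∘L ((PiLp.continuousLinearEquiv p ℂ (fun _ : Fin r => ℂ)).symm :
      (Fin r → ℂ) →L[ℂ] PiLp p (fun _ : Fin r => ℂ)) ∘L
    ContinuousLinearMap.pi fun l =>
      innerSL ℂ (f l i) ∘L ContinuousLinearMap.apply ℂ (Lp ℂ 2 ν) (e l j) ∘L kernelOpL
  refine ⟨fun i j => (InnerProductSpace.toDual ℂ (HSKernel ν)).symm (κ i j), fun c => ?_⟩
  simp_rw [InnerProductSpace.toDual_symm_apply]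
  have : pairingVec p e f (blockOp (c.map kernelOp)) =
      ∑ i, ∑ j, WithLp.toLp p fun l => inner ℂ (f l i) (kernelOp (c i j) (e l j)) := by
    ext l
    simp only [pairingVec, inner_blockOp, Matrix.map_apply]
    simp [WithLp.ofLp_sum, Finset.sum_apply]
  rw [this]
  simp_rw [map_sum]
  rfl

end Duality

/-! ### Norm estimates for lifts -/

section TwistNorm

variable {X : Type*} [MeasurableSpace X] {ν : Measure X} {d : ℕ}
  {S T : Type*} [TopologicalSpace S] [TopologicalSpace T]

/-- The map `(s, t) ↦ b₁ s + b₂ t`. -/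
def sumMap (b₁ : C(S, EuclideanSpace ℝ (Fin d))) (b₂ : C(T, EuclideanSpace ℝ (Fin d))) :
    C(S × T, EuclideanSpace ℝ (Fin d)) :=
  ⟨fun z => b₁ z.1 + b₂ z.2, by fun_prop⟩

theorem charBCF_sumMap (b₁ : C(S, EuclideanSpace ℝ (Fin d))) (b₂ : C(T, EuclideanSpace ℝ (Fin d)))
    (x : EuclideanSpace ℝ (Fin d)) (s : S) (t : T) :
    charBCF (sumMap b₁ b₂) x (s, t) = charBCF b₁ x s * charBCF b₂ x t := by
  simp only [charBCF_apply, sumMap, ContinuousMap.coe_mk]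
  rw [inner_add_right, AddChar.map_add_eq_mul, Circle.coe_mul]

theorem norm_charBCF_apply {Z : Type*} [TopologicalSpace Z] (b : C(Z, EuclideanSpace ℝ (Fin d)))
    (x : EuclideanSpace ℝ (Fin d)) (z : Z) : ‖charBCF b x z‖ = 1 := by
  rw [charBCF_apply, Circle.norm_coe]

variable [MeasurableSpace T] [BorelSpace T]
  {P : X → S} {Q : X → T} [SecondCountableTopology S] [TopologicalSpace.PseudoMetrizableSpace S]
  [MeasurableSpace S] [BorelSpace S] (hP : Measurable P) (hQ : Measurable Q)
  (b₁ : C(S, EuclideanSpace ℝ (Fin d))) (b₂ : C(T, EuclideanSpace ℝ (Fin d)))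
  {p : ℝ≥0∞} [Fact (1 ≤ p)] {n : ℕ}

theorem matrixSchattenNorm_smul_charBCF_le (c : ℂ) (x : EuclideanSpace ℝ (Fin d))
    (a : Matrix (Fin n) (Fin n) (HSKernel ν)) :
    matrixSchattenNorm p (a.map fun k => c • schurMul hP hQ (charBCF (sumMap b₁ b₂) x) k) ≤
      ‖c‖ₑ * matrixSchattenNorm p a :=
  matrixSchattenNorm_smul_schurMul_le hP hQ (c₁ := fun g => charBCF b₁ x (P g))
    (c₂ := fun h => charBCF b₂ x (Q h))
    ((charBCF b₁ x).continuous.measurable.comp hP).aestronglyMeasurable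
    (fun _ => norm_charBCF_apply _ _ _)
    ((charBCF b₂ x).continuous.measurable.comp hQ).aestronglyMeasurable
    (fun _ => norm_charBCF_apply _ _ _) (fun _ _ => charBCF_sumMap b₁ b₂ x _ _) c a

theorem matrixSchattenNorm_star_charBCF_le (x : EuclideanSpace ℝ (Fin d))
    (a : Matrix (Fin n) (Fin n) (HSKernel ν)) :
    matrixSchattenNorm p (a.map fun k => schurMul hP hQ (star (charBCF (sumMap b₁ b₂) x)) k) ≤
      matrixSchattenNorm p a := by
  have h := matrixSchattenNorm_smul_schurMul_le (p := p) (ν := ν) hP hQ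
    (f := star (charBCF (sumMap b₁ b₂) x))
    (c₁ := fun g => star (charBCF b₁ x) (P g))
    (c₂ := fun h => star (charBCF b₂ x) (Q h))
    ((star (charBCF b₁ x)).continuous.measurable.comp hP).aestronglyMeasurable
    (fun _ => (norm_star _).trans (norm_charBCF_apply _ _ _))
    ((star (charBCF b₂ x)).continuous.measurable.comp hQ).aestronglyMeasurable
    (fun _ => (norm_star _).trans (norm_charBCF_apply _ _ _))
    (fun g h => by
      simp only [star_apply, charBCF_sumMap, star_mul']) 1 a
  simpa only [one_smul, enorm_one, one_mul] using h

theorem matrixLpNorm_twist_le (φ : 𝓢(EuclideanSpace ℝ (Fin d), ℂ))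
    {a : Matrix (Fin n) (Fin n) (HSKernel ν)} (ha : matrixSchattenNorm p a ≠ ∞) :
    matrixLpNorm p (a.map (twist hP hQ (sumMap b₁ b₂) φ)) ≤
      eLpNorm φ p volume * matrixSchattenNorm p a := by
  have h1 : ∀ᵐ x, ∀ i j, (twist hP hQ (sumMap b₁ b₂) φ (a i j)) x =
      φ x • schurMul hP hQ (charBCF (sumMap b₁ b₂) x) (a i j) :=
    ae_all_iff.2 fun i => ae_all_iff.2 fun j => coeFn_twist hP hQ _ φ (a i j)
  have h2 : matrixLpNorm p (a.map (twist hP hQ (sumMap b₁ b₂) φ)) ≤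
      eLpNorm (((matrixSchattenNorm p a).toReal : ℂ) • ⇑φ) p volume := by
    refine eLpNorm_mono_enorm_ae ?_
    filter_upwards [h1] with x hx
    rw [enorm_eq_self, Pi.smul_apply, enorm_smul]
    have h3 : ‖((matrixSchattenNorm p a).toReal : ℂ)‖ₑ = matrixSchattenNorm p a := by
      rw [← ofReal_norm, Complex.norm_real, Real.norm_of_nonneg ENNReal.toReal_nonneg,
        ENNReal.ofReal_toReal ha]
    rw [h3, mul_comm]
    refine le_trans (le_of_eq ?_) (matrixSchattenNorm_smul_charBCF_le hP hQ b₁ b₂ (φ x) x a)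
    congr 1
    ext i j : 1
    exact hx i j
  refine h2.trans (le_of_eq ?_)
  rw [eLpNorm_const_smul, mul_comm, ← ofReal_norm, Complex.norm_real,
    Real.norm_of_nonneg ENNReal.toReal_nonneg, ENNReal.ofReal_toReal ha]

/-- Removing the modulation from the `k` side conjugates it onto `y(x)`, where it does not increase
the norm; `k` then acts as the contractive functional `θ`, and Hölder in `x` finishes. -/
theorem enorm_sum_inner_twist_le {q : ℝ≥0∞} [ENNReal.HolderTriple q p 1]
    (φ : 𝓢(EuclideanSpace ℝ (Fin d), ℂ)) {r : ℕ}
    {e f : Fin r → PiLp 2 (fun _ : Fin n => Lp ℂ 2 ν)}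
    (he : Orthonormal ℂ e) (hf : Orthonormal ℂ f)
    {θ : PiLp p (fun _ : Fin r => ℂ) →L[ℂ] ℂ} (hθ : ‖θ‖ ≤ 1)
    {k : Matrix (Fin n) (Fin n) (HSKernel ν)}
    (hk : ∀ c : Matrix (Fin n) (Fin n) (HSKernel ν),
      θ (pairingVec p e f (blockOp (c.map kernelOp))) = ∑ i, ∑ j, inner ℂ (k i j) (c i j))
    (y : Matrix (Fin n) (Fin n) (L2HS ν d)) :
    ‖∑ i, ∑ j, inner ℂ (twist hP hQ (sumMap b₁ b₂) φ (k i j)) (y i j)‖ₑ ≤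
      eLpNorm φ q volume * matrixLpNorm p y := by
  -- Hölder is applied to this measurable scalar function, which is dominated by the Schatten norm
  -- of `y(x)`; measurability of the norm itself is never needed.
  let ψ : EuclideanSpace ℝ (Fin d) → ℂ := fun x => ∑ i, ∑ j,
    inner ℂ (schurMul hP hQ (charBCF (sumMap b₁ b₂) x) (k i j)) (y i j x)
  have hψm : AEStronglyMeasurable ψ volume := by
    refine Finset.aestronglyMeasurable_fun_sum _ fun i _ =>
      Finset.aestronglyMeasurable_fun_sum _ fun j _ => ?_
    exact (continuous_schurMul_charBCF hP hQ _ (k i j)).aestronglyMeasurable.inner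
      (Lp.aestronglyMeasurable (y i j))
  have hψ : ∀ x, ‖ψ x‖ₑ ≤ matrixSchattenNorm p (y.map fun yij => (yij x : HSKernel ν)) := fun x => by
    have e1 : ψ x = θ (pairingVec p e f (blockOp (((y.map fun yij => (yij x : HSKernel ν)).map
        fun l => schurMul hP hQ (star (charBCF (sumMap b₁ b₂) x)) l).map kernelOp))) := by
      rw [hk]
      simp only [ψ, inner_schurMul_left, Matrix.map_apply]
    rw [e1]
    refine le_trans ?_ ((enorm_pairingVec_le (isCompactOperator_blockOp_kernelOp _) he hf).trans
      (matrixSchattenNorm_star_charBCF_le hP hQ b₁ b₂ x _))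
    rw [enorm_le_iff_norm_le]
    exact θ.le_of_opNorm_le_of_le hθ le_rfl |>.trans (by rw [one_mul])
  have hsum : ∑ i, ∑ j, inner ℂ (twist hP hQ (sumMap b₁ b₂) φ (k i j)) (y i j) =
      ∫ x, star (φ x) • ψ x := by
    simp only [ψ, Finset.smul_sum]
    have hint : ∀ i j, Integrable fun x => star (φ x) •
        inner ℂ (schurMul hP hQ (charBCF (sumMap b₁ b₂) x) (k i j)) (y i j x) := fun i j => by
      refine (L2.integrable_inner (𝕜 := ℂ) (twist hP hQ (sumMap b₁ b₂) φ (k i j)) (y i j)).congr ?_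
      filter_upwards [coeFn_twist hP hQ (sumMap b₁ b₂) φ (k i j)] with x hx
      rw [hx, inner_smul_left]; rfl
    rw [integral_finsetSum _ fun i _ => integrable_finsetSum _ fun j _ => hint i j]
    refine Finset.sum_congr rfl fun i _ => ?_
    rw [integral_finsetSum _ fun j _ => hint i j]
    refine Finset.sum_congr rfl fun j _ => ?_
    rw [L2.inner_def]
    refine integral_congr_ae ?_
    filter_upwards [coeFn_twist hP hQ (sumMap b₁ b₂) φ (k i j)] with x hx
    rw [hx, inner_smul_left]; rfl
  rw [hsum]
  refine (enorm_integral_le_lintegral_enorm _).trans ?_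
  rw [← eLpNorm_one_eq_lintegral_enorm]
  refine (eLpNorm_smul_le_mul_eLpNorm (p := q) (q := p) (r := 1) hψm
    (φ.continuous.star.aestronglyMeasurable)).trans ?_
  gcongr
  · exact (eLpNorm_congr_norm_ae (Eventually.of_forall fun x => norm_star _)).le
  · exact eLpNorm_mono_enorm fun x => by rw [enorm_eq_self]; exact hψ x

end TwistNorm

/-! ### Scaling of Schwartz functions -/

section Dilation

variable {d : ℕ}

/-- The dilation `x ↦ φ(c x)` of a Schwartz function. -/
def dil (c : ℝˣ) (φ : 𝓢(EuclideanSpace ℝ (Fin d), ℂ)) : 𝓢(EuclideanSpace ℝ (Fin d), ℂ) :=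
  compCLMOfContinuousLinearEquiv ℂ (ContinuousLinearEquiv.smulLeft c) φ

theorem dil_apply (c : ℝˣ) (φ : 𝓢(EuclideanSpace ℝ (Fin d), ℂ)) (x : EuclideanSpace ℝ (Fin d)) :
    dil c φ x = φ ((c : ℝ) • x) := rfl

theorem fourier_dil (c : ℝˣ) (φ : 𝓢(EuclideanSpace ℝ (Fin d), ℂ))
    (ξ : EuclideanSpace ℝ (Fin d)) :
    𝓕 (dil c φ) ξ = (|((c : ℝ) ^ d)⁻¹| : ℝ) • 𝓕 φ ((c : ℝ)⁻¹ • ξ) := by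
  rw [fourier_coe, fourier_coe, Real.fourier_eq, Real.fourier_eq]
  have h := Measure.integral_comp_smul (volume : Measure (EuclideanSpace ℝ (Fin d)))
    (fun v => Real.fourierChar (-inner ℝ v ((c : ℝ)⁻¹ • ξ)) • φ v) (c : ℝ)
  rw [finrank_euclideanSpace_fin] at h
  rw [← h]
  refine integral_congr_ae (Eventually.of_forall fun v => ?_)
  simp only [dil_apply, inner_smul_left, inner_smul_right]
  simp

theorem eLpNorm_dil (c : ℝˣ) (φ : 𝓢(EuclideanSpace ℝ (Fin d), ℂ)) (p : ℝ≥0∞) :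
    eLpNorm (dil c φ) p volume =
      ENNReal.ofReal |((c : ℝ) ^ d)⁻¹| ^ (p⁻¹).toReal * eLpNorm φ p volume := by
  have h := (MeasurableEquiv.smul₀ (α := EuclideanSpace ℝ (Fin d)) (c : ℝ) c.ne_zero
    ).measurableEmbedding.eLpNorm_map_measure (g := φ) (p := p) (μ := volume)
  have h2 := Measure.map_addHaar_smul (volume : Measure (EuclideanSpace ℝ (Fin d))) c.ne_zero
  rw [finrank_euclideanSpace_fin] at h2
  change eLpNorm φ p (Measure.map (fun x => (c : ℝ) • x) volume) = eLpNorm (dil c φ) p volume at h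
  rw [← h, h2, eLpNorm_smul_measure_of_ne_zero, one_div, smul_eq_mul]
  simp

/-- Conjugate exponents make the product scale like `|c|^{-d}`, exactly as the mass of `|φ̂|²` does
under dilation. -/
theorem eLpNorm_dil_mul_eLpNorm_dil (c : ℝˣ) (φ : 𝓢(EuclideanSpace ℝ (Fin d), ℂ)) (p q : ℝ≥0∞)
    [hpq : ENNReal.HolderTriple q p 1] :
    eLpNorm (dil c φ) p volume * eLpNorm (dil c φ) q volume =
      ENNReal.ofReal |((c : ℝ) ^ d)⁻¹| * (eLpNorm φ p volume * eLpNorm φ q volume) := by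
  have h := hpq.inv_add_inv_eq_inv
  rw [inv_one] at h
  have hp : p⁻¹ ≠ ∞ := fun h' => by simp [h'] at h
  have hq : q⁻¹ ≠ ∞ := fun h' => by simp [h'] at h
  have h1 : (p⁻¹).toReal + (q⁻¹).toReal = 1 := by
    rw [← ENNReal.toReal_add hp hq, add_comm, h, ENNReal.toReal_one]
  rw [eLpNorm_dil, eLpNorm_dil, mul_mul_mul_comm, ← ENNReal.rpow_add_of_nonneg _ _
    ENNReal.toReal_nonneg ENNReal.toReal_nonneg, h1, ENNReal.rpow_one]

/-- For small `c` the measure `|𝓕 (dil c φ)|² dξ` lives at scale `c`; rescaling puts `c` into the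
argument of `F` instead. -/
theorem integral_norm_sq_fourier_dil_smul {E : Type*} [NormedAddCommGroup E] [NormedSpace ℂ E]
    (c : ℝˣ) (φ : 𝓢(EuclideanSpace ℝ (Fin d), ℂ)) (F : EuclideanSpace ℝ (Fin d) → E) :
    ∫ ξ, ((‖𝓕 (dil c φ) ξ‖ ^ 2 : ℝ) : ℂ) • F ξ =
      ((|((c : ℝ) ^ d)⁻¹| : ℝ) : ℂ) • ∫ ξ, ((‖𝓕 φ ξ‖ ^ 2 : ℝ) : ℂ) • F ((c : ℝ) • ξ) := by
  have h := Measure.integral_comp_inv_smul (volume : Measure (EuclideanSpace ℝ (Fin d)))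
    (fun ξ => ((‖𝓕 φ ξ‖ ^ 2 : ℝ) : ℂ) • F ((c : ℝ) • ξ)) (c : ℝ)
  rw [finrank_euclideanSpace_fin] at h
  have h0 : (|((c : ℝ) ^ d)⁻¹| : ℝ) * |(c : ℝ) ^ d| = 1 := by
    rw [abs_inv, inv_mul_cancel₀]; simp
  have h1 : ∀ ξ, ((‖𝓕 (dil c φ) ξ‖ ^ 2 : ℝ) : ℂ) • F ξ = ((|((c : ℝ) ^ d)⁻¹| ^ 2 : ℝ) : ℂ) •
      (((‖𝓕 φ ((c : ℝ)⁻¹ • ξ)‖ ^ 2 : ℝ) : ℂ) • F ((c : ℝ) • (c : ℝ)⁻¹ • ξ)) := fun ξ => by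
    rw [fourier_dil, norm_smul, mul_pow, Complex.ofReal_mul, mul_smul, smul_inv_smul₀ c.ne_zero,
      Real.norm_eq_abs, abs_abs]
  simp_rw [h1]
  rw [integral_smul, h, ← Complex.coe_smul, smul_smul, ← Complex.ofReal_mul, pow_two, mul_assoc, h0,
    mul_one]

end Dilation

/-! ### Transference in the limit of wide dilations -/

section Transfer

variable {X : Type*} [MeasurableSpace X] {ν : Measure X} {d : ℕ}
  {S T : Type*} [TopologicalSpace S] [TopologicalSpace T]
  [MeasurableSpace T] [BorelSpace T]
  {P : X → S} {Q : X → T} [SecondCountableTopology S] [TopologicalSpace.PseudoMetrizableSpace S]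
  [MeasurableSpace S] [BorelSpace S] (hP : Measurable P) (hQ : Measurable Q)

theorem tendsto_integral_schurMul_transBCF (b : C(S × T, EuclideanSpace ℝ (Fin d)))
    (φ : 𝓢(EuclideanSpace ℝ (Fin d), ℂ)) (M : EuclideanSpace ℝ (Fin d) × S →ᵇ ℂ)
    {u : ℕ → ℝˣ} (hu : Tendsto (fun m => (u m : ℝ)) atTop (𝓝 0)) (a : HSKernel ν) :
    Tendsto (fun m => ∫ ξ, ((‖φ ξ‖ ^ 2 : ℝ) : ℂ) • schurMul hP hQ
        (transBCF b M ((u m : ℝ) • ξ)) a) atTop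
      (𝓝 (((∫ ξ, ‖φ ξ‖ ^ 2 : ℝ) : ℂ) • schurMul hP hQ (transBCF b M 0) a)) := by
  rw [← integral_complex_ofReal, ← integral_smul_const]
  refine tendsto_integral_of_dominated_convergence
    (fun ξ => ‖((‖φ ξ‖ ^ 2 : ℝ) : ℂ)‖ * (‖M‖ * ‖a‖)) (fun m => ?_)
    ((integrable_norm_sq φ).norm.mul_const _) (fun m => Eventually.of_forall fun ξ => ?_)
    (Eventually.of_forall fun ξ => ?_)
  · exact (integrable_smul_schurMul hP hQ (integrable_norm_sq φ)
      (f := fun ξ => transBCF b M ((u m : ℝ) • ξ)) (fun _ => norm_transBCF_le b M _)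
      (fun z => (continuous_transBCF_apply b M z).comp (continuous_const_smul _)) a).1
  · rw [norm_smul]
    gcongr
    exact (norm_schurMul_apply_le hP hQ _ a).trans
      (mul_le_mul_of_nonneg_right (norm_transBCF_le b M _) (norm_nonneg a))
  · refine tendsto_const_nhds.smul (tendsto_schurMul hP hQ (fun _ => norm_transBCF_le b M _)
      (norm_transBCF_le b M _) (fun z => ?_) a)
    refine ((continuous_transBCF_apply b M z).tendsto 0).comp ?_
    simpa using hu.smul_const ξ

variable [FirstCountableTopology T]
  (b₁ : C(S, EuclideanSpace ℝ (Fin d))) (b₂ : C(T, EuclideanSpace ℝ (Fin d)))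
  {p q : ℝ≥0∞} [Fact (1 ≤ p)] [ENNReal.HolderTriple q p 1] {n : ℕ}

/-- The factor `|c|^{-d}` appears on both sides and cancels, leaving a bound independent of the
dilation. -/
theorem enorm_sum_inner_integral_schurMul_le (φ : 𝓢(EuclideanSpace ℝ (Fin d), ℂ))
    (M : EuclideanSpace ℝ (Fin d) × S →ᵇ ℂ) {C : ℝ≥0∞}
    {a : Matrix (Fin n) (Fin n) (HSKernel ν)} (c : ℝˣ)
    {y : Matrix (Fin n) (Fin n) (L2HS ν d)} (ha : matrixSchattenNorm p a ≠ ∞)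
    (hy : ∀ i j, IsTwistedMultiplierImage (fun g ξ => M (ξ, P g))
      (twist hP hQ (sumMap b₁ b₂) (dil c φ) (a i j)) (y i j))
    (hyC : matrixLpNorm p y ≤
      C * matrixLpNorm p (a.map (twist hP hQ (sumMap b₁ b₂) (dil c φ))))
    {r : ℕ} {e f : Fin r → PiLp 2 (fun _ : Fin n => Lp ℂ 2 ν)}
    (he : Orthonormal ℂ e) (hf : Orthonormal ℂ f)
    {θ : PiLp p (fun _ : Fin r => ℂ) →L[ℂ] ℂ} (hθ : ‖θ‖ ≤ 1)
    {k : Matrix (Fin n) (Fin n) (HSKernel ν)}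
    (hk : ∀ c : Matrix (Fin n) (Fin n) (HSKernel ν),
      θ (pairingVec p e f (blockOp (c.map kernelOp))) = ∑ i, ∑ j, inner ℂ (k i j) (c i j)) :
    ‖∑ i, ∑ j, inner ℂ (k i j) (∫ ξ, ((‖𝓕 φ ξ‖ ^ 2 : ℝ) : ℂ) •
        schurMul hP hQ (transBCF (sumMap b₁ b₂) M ((c : ℝ) • ξ)) (a i j))‖ₑ ≤
      C * (eLpNorm φ p volume * eLpNorm φ q volume) * matrixSchattenNorm p a := by
  have h1 := enorm_sum_inner_twist_le (q := q) hP hQ b₁ b₂ (dil c φ) he hf hθ hk y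
  have h0 : ∑ i, ∑ j, inner ℂ (twist hP hQ (sumMap b₁ b₂) (dil c φ) (k i j)) (y i j) =
      ((|((c : ℝ) ^ d)⁻¹| : ℝ) : ℂ) * ∑ i, ∑ j, inner ℂ (k i j) (∫ ξ, ((‖𝓕 φ ξ‖ ^ 2 : ℝ) : ℂ) •
        schurMul hP hQ (transBCF (sumMap b₁ b₂) M ((c : ℝ) • ξ)) (a i j)) := by
    simp_rw [Finset.mul_sum]
    refine Finset.sum_congr rfl fun i _ => Finset.sum_congr rfl fun j _ => ?_
    rw [inner_twist hP hQ _ (dil c φ) _ M (hy i j)]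
    exact (congrArg (inner ℂ (k i j)) (integral_norm_sq_fourier_dil_smul c φ
      fun ξ => schurMul hP hQ (transBCF (sumMap b₁ b₂) M ξ) (a i j))).trans (inner_smul_right _ _ _)
  rw [h0, enorm_mul] at h1
  have h2 : ‖((|((c : ℝ) ^ d)⁻¹| : ℝ) : ℂ)‖ₑ = ENNReal.ofReal |((c : ℝ) ^ d)⁻¹| := by
    rw [← ofReal_norm, Complex.norm_real, Real.norm_eq_abs, abs_abs]
  rw [h2] at h1
  have h3 : ENNReal.ofReal |((c : ℝ) ^ d)⁻¹| ≠ 0 := by simp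
  rw [← ENNReal.mul_le_mul_iff_right h3 ENNReal.ofReal_ne_top]
  refine h1.trans ?_
  calc eLpNorm (dil c φ) q volume * matrixLpNorm p y
      ≤ eLpNorm (dil c φ) q volume *
          (C * (eLpNorm (dil c φ) p volume * matrixSchattenNorm p a)) := by
        gcongr
        refine hyC.trans ?_
        gcongr
        exact matrixLpNorm_twist_le hP hQ b₁ b₂ (dil c φ) ha
    _ = C * (eLpNorm (dil c φ) p volume * eLpNorm (dil c φ) q volume) *
          matrixSchattenNorm p a := by ring
    _ = _ := by rw [eLpNorm_dil_mul_eLpNorm_dil]; ring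

/-- Fix orthonormal families and a functional norming the target vector, then let `u m → 0`: the
averaged symbol tends to its value at `b`, times `‖φ̂‖₂² = ‖φ‖₂²`. The hypothesis is required only
eventually, because the localised test functions below are admissible only for small dilations. -/
theorem matrixSchattenNorm_schurMul_transBCF_le (φ : 𝓢(EuclideanSpace ℝ (Fin d), ℂ))
    (M : EuclideanSpace ℝ (Fin d) × S →ᵇ ℂ) {C : ℝ≥0∞}
    {a : Matrix (Fin n) (Fin n) (HSKernel ν)} (ha : matrixSchattenNorm p a ≠ ∞)
    {u : ℕ → ℝˣ} (hu : Tendsto (fun m => (u m : ℝ)) atTop (𝓝 0))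
    (h : ∀ᶠ m in atTop, ∃ y : Matrix (Fin n) (Fin n) (L2HS ν d),
      (∀ i j, IsTwistedMultiplierImage (fun g ξ => M (ξ, P g))
        (twist hP hQ (sumMap b₁ b₂) (dil (u m) φ) (a i j)) (y i j)) ∧
      matrixLpNorm p y ≤
        C * matrixLpNorm p (a.map (twist hP hQ (sumMap b₁ b₂) (dil (u m) φ)))) :
    ENNReal.ofReal (∫ x, ‖φ x‖ ^ 2) *
        matrixSchattenNorm p (a.map (schurMul hP hQ (transBCF (sumMap b₁ b₂) M 0))) ≤
      C * (eLpNorm φ p volume * eLpNorm φ q volume) * matrixSchattenNorm p a := by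
  rcases eq_or_ne (ENNReal.ofReal (∫ x, ‖φ x‖ ^ 2)) 0 with h0 | h0
  · rw [h0, zero_mul]; exact zero_le
  rw [mul_comm, ← ENNReal.le_div_iff_mul_le (Or.inl h0) (Or.inl ENNReal.ofReal_ne_top)]
  refine schattenNorm_le_of_pairingVec_le (isCompactOperator_blockOp_kernelOp _)
    fun r e f he hf => ?_
  rw [ENNReal.le_div_iff_mul_le (Or.inl h0) (Or.inl ENNReal.ofReal_ne_top)]
  obtain ⟨θ, hθ, hθv⟩ := exists_dual_vector'' ℂ (pairingVec p e f (blockOp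
    ((a.map (schurMul hP hQ (transBCF (sumMap b₁ b₂) M 0))).map kernelOp)))
  obtain ⟨k, hk⟩ := exists_inner_eq_dual_pairingVec e f θ
  have hlim : Tendsto (fun m => ∑ i, ∑ j, inner ℂ (k i j) (∫ ξ, ((‖𝓕 φ ξ‖ ^ 2 : ℝ) : ℂ) •
        schurMul hP hQ (transBCF (sumMap b₁ b₂) M ((u m : ℝ) • ξ)) (a i j))) atTop
      (𝓝 (∑ i, ∑ j, inner ℂ (k i j) (((∫ ξ, ‖𝓕 φ ξ‖ ^ 2 : ℝ) : ℂ) •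
        schurMul hP hQ (transBCF (sumMap b₁ b₂) M 0) (a i j)))) :=
    tendsto_finsetSum _ fun i _ => tendsto_finsetSum _ fun j _ =>
      tendsto_const_nhds.inner (tendsto_integral_schurMul_transBCF hP hQ _ (𝓕 φ) M hu (a i j))
  have hle := le_of_tendsto hlim.enorm (h.mono fun m ⟨y, hy, hyC⟩ =>
    enorm_sum_inner_integral_schurMul_le (q := q) hP hQ b₁ b₂ φ M (u m) ha hy hyC he hf hθ hk)
  refine le_trans (le_of_eq ?_) hle
  simp_rw [inner_smul_right, ← Finset.mul_sum]
  have := hk (a.map (schurMul hP hQ (transBCF (sumMap b₁ b₂) M 0)))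
  simp only [Matrix.map_apply] at this
  rw [← this, hθv, integral_norm_sq_fourier, enorm_mul, mul_comm, ← ofReal_norm, ← ofReal_norm,
    ← ofReal_norm, Complex.norm_real, RCLike.norm_ofReal, abs_norm,
    Real.norm_of_nonneg (integral_nonneg fun x => by positivity)]

end Transfer

/-! ### Bumps close to the indicator of a ball -/

section Bump

variable {d : ℕ}

/-- A smooth compactly supported bump as a complex Schwartz function. -/
def bumpSchwartz {c : EuclideanSpace ℝ (Fin d)} (f : ContDiffBump c) :
    𝓢(EuclideanSpace ℝ (Fin d), ℂ) :=
  (f.hasCompactSupport.comp_left (g := fun r : ℝ => (r : ℂ)) Complex.ofReal_zero).toSchwartzMap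
    (Complex.ofRealCLM.contDiff.comp f.contDiff)

theorem bumpSchwartz_apply {c : EuclideanSpace ℝ (Fin d)} (f : ContDiffBump c)
    (x : EuclideanSpace ℝ (Fin d)) : bumpSchwartz f x = (f x : ℂ) := rfl

theorem eLpNorm_bumpSchwartz_le {c : EuclideanSpace ℝ (Fin d)} (f : ContDiffBump c) (p : ℝ≥0∞) :
    eLpNorm (bumpSchwartz f) p volume ≤ volume (Metric.ball c f.rOut) ^ (p⁻¹).toReal := by
  have h1 : eLpNorm (bumpSchwartz f) p volume ≤
      eLpNorm ((Metric.ball c f.rOut).indicator fun _ => (1 : ℂ)) p volume := by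
    refine eLpNorm_mono fun x => ?_
    rw [bumpSchwartz_apply, Complex.norm_real, Real.norm_of_nonneg f.nonneg]
    by_cases hx : x ∈ Metric.ball c f.rOut
    · rw [Set.indicator_of_mem hx, norm_one]
      exact f.le_one
    · rw [f.zero_of_le_dist (by simpa using hx)]
      exact norm_nonneg _
  refine h1.trans ((eLpNorm_indicator_const_le _ _).trans ?_)
  rw [enorm_one, one_mul, ENNReal.toReal_inv, one_div]

theorem volume_ball_le_integral_norm_sq_bumpSchwartz {c : EuclideanSpace ℝ (Fin d)}
    (f : ContDiffBump c) :
    volume (Metric.ball c f.rIn) ≤ ENNReal.ofReal (∫ x, ‖bumpSchwartz f x‖ ^ 2) := by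
  rw [ofReal_integral_eq_lintegral_ofReal
    (((bumpSchwartz f).memLp 2 volume).integrable_norm_pow (by norm_num))
    (Eventually.of_forall fun x => by positivity),
    ← lintegral_indicator_one Metric.isOpen_ball.measurableSet]
  refine lintegral_mono fun x => ?_
  by_cases hx : x ∈ Metric.ball c f.rIn
  · rw [Set.indicator_of_mem hx, bumpSchwartz_apply,
      f.one_of_mem_closedBall (Metric.ball_subset_closedBall hx)]
    simp
  · rw [Set.indicator_of_notMem hx]
    exact zero_le

theorem eLpNorm_bumpSchwartz_mul_le {c : EuclideanSpace ℝ (Fin d)} (f : ContDiffBump c)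
    (p q : ℝ≥0∞) [hpq : ENNReal.HolderTriple q p 1] :
    eLpNorm (bumpSchwartz f) p volume * eLpNorm (bumpSchwartz f) q volume ≤
      volume (Metric.ball c f.rOut) := by
  have h := hpq.inv_add_inv_eq_inv
  rw [inv_one] at h
  have hp : p⁻¹ ≠ ∞ := fun h' => by simp [h'] at h
  have hq : q⁻¹ ≠ ∞ := fun h' => by simp [h'] at h
  have h1 : (p⁻¹).toReal + (q⁻¹).toReal = 1 := by
    rw [← ENNReal.toReal_add hp hq, add_comm, h, ENNReal.toReal_one]
  refine (mul_le_mul' (eLpNorm_bumpSchwartz_le f p) (eLpNorm_bumpSchwartz_le f q)).trans ?_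
  rw [← ENNReal.rpow_add_of_nonneg _ _ ENNReal.toReal_nonneg ENNReal.toReal_nonneg, h1,
    ENNReal.rpow_one]

end Bump

/-! ### Sharp transference for bounded symbols -/

section BoundedTransfer

variable {X : Type*} [MeasurableSpace X] {ν : Measure X} {d : ℕ}
  {S T : Type*} [TopologicalSpace S] [TopologicalSpace T]
  [MeasurableSpace T] [BorelSpace T] [FirstCountableTopology T]
  {P : X → S} {Q : X → T} [SecondCountableTopology S] [TopologicalSpace.PseudoMetrizableSpace S]
  [MeasurableSpace S] [BorelSpace S] (hP : Measurable P) (hQ : Measurable Q)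
  (b₁ : C(S, EuclideanSpace ℝ (Fin d))) (b₂ : C(T, EuclideanSpace ℝ (Fin d)))
  {p : ℝ≥0∞} [Fact (1 ≤ p)] {n : ℕ}

theorem exists_units_tendsto_zero : ∃ u : ℕ → ℝˣ, Tendsto (fun m => (u m : ℝ)) atTop (𝓝 0) :=
  ⟨fun m => Units.mk0 (1 / ((m : ℝ) + 1)) (by positivity), tendsto_one_div_add_atTop_nhds_zero_nat⟩

theorem matrixSchattenNorm_transBCF_le_of_twisted (M : EuclideanSpace ℝ (Fin d) × S →ᵇ ℂ)
    {C : ℝ≥0∞} (hC : C ≠ ∞) {a : Matrix (Fin n) (Fin n) (HSKernel ν)}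
    (ha : matrixSchattenNorm p a ≠ ∞)
    (h : ∀ φ : 𝓢(EuclideanSpace ℝ (Fin d), ℂ), ∃ y : Matrix (Fin n) (Fin n) (L2HS ν d),
      (∀ i j, IsTwistedMultiplierImage (fun g ξ => M (ξ, P g))
        (twist hP hQ (sumMap b₁ b₂) φ (a i j)) (y i j)) ∧
      matrixLpNorm p y ≤ C * matrixLpNorm p (a.map (twist hP hQ (sumMap b₁ b₂) φ))) :
    matrixSchattenNorm p (a.map (schurMul hP hQ (transBCF (sumMap b₁ b₂) M 0))) ≤
      C * matrixSchattenNorm p a := by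
  have := (ENNReal.HolderConjugate.inv_one_sub_inv' (Fact.out : 1 ≤ p)).symm
  obtain ⟨u, hu⟩ := exists_units_tendsto_zero
  set v : ℝ≥0∞ := volume (Metric.ball (0 : EuclideanSpace ℝ (Fin d)) 1) with hv
  have hv0 : v ≠ 0 := (Metric.measure_ball_pos volume _ one_pos).ne'
  have hvt : v ≠ ∞ := measure_ball_lt_top.ne
  have key : ∀ m : ℕ, matrixSchattenNorm p
      (a.map (schurMul hP hQ (transBCF (sumMap b₁ b₂) M 0))) ≤
        ENNReal.ofReal ((1 + 1 / ((m : ℝ) + 1)) ^ d) * (C * matrixSchattenNorm p a) := fun m => by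
    have hm : (0 : ℝ) < 1 / ((m : ℝ) + 1) := by positivity
    -- Equal to `1` on the unit ball and vanishing outside radius `1 + 1/(m+1)`: the ratio `‖φ‖_p
    -- ‖φ‖_q / ‖φ‖₂²` is at most `(1 + 1/(m+1))^d`, which tends to `1`.
    let f : ContDiffBump (0 : EuclideanSpace ℝ (Fin d)) :=
      ⟨1, 1 + 1 / ((m : ℝ) + 1), one_pos, by linarith⟩
    have h1 := matrixSchattenNorm_schurMul_transBCF_le (q := (1 - p⁻¹)⁻¹) hP hQ b₁ b₂
      (bumpSchwartz f) M ha hu (Eventually.of_forall fun m => h (dil (u m) (bumpSchwartz f)))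
    have h2 : volume (Metric.ball (0 : EuclideanSpace ℝ (Fin d)) f.rOut) =
        ENNReal.ofReal ((1 + 1 / ((m : ℝ) + 1)) ^ d) * v := by
      rw [Measure.addHaar_ball_of_pos _ _ f.rOut_pos, finrank_euclideanSpace_fin]
    rw [← ENNReal.mul_le_mul_iff_right hv0 hvt]
    calc v * _ ≤ _ := mul_le_mul' (volume_ball_le_integral_norm_sq_bumpSchwartz f) le_rfl
      _ ≤ _ := h1
      _ ≤ C * volume (Metric.ball (0 : EuclideanSpace ℝ (Fin d)) f.rOut) *
          matrixSchattenNorm p a := by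
        gcongr
        exact eLpNorm_bumpSchwartz_mul_le f p _
      _ = _ := by rw [h2]; ring
  have hlim : Tendsto (fun m : ℕ => ENNReal.ofReal ((1 + 1 / ((m : ℝ) + 1)) ^ d) *
      (C * matrixSchattenNorm p a)) atTop (𝓝 (ENNReal.ofReal ((1 + 0) ^ d) *
      (C * matrixSchattenNorm p a))) :=
    ENNReal.Tendsto.mul_const (ENNReal.tendsto_ofReal
      ((tendsto_one_div_add_atTop_nhds_zero_nat.const_add 1).pow d))
      (Or.inr (ENNReal.mul_ne_top hC ha))
  simpa using ge_of_tendsto' hlim key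

end BoundedTransfer

/-! ### Rank one operators and matrix coefficients -/

section RankOne

variable {H : Type*} [NormedAddCommGroup H] [InnerProductSpace ℂ H] [CompleteSpace H]
  {p : ℝ≥0∞} [Fact (1 ≤ p)]

theorem norm_piLp_le_sum {n : ℕ} (v : PiLp p (fun _ : Fin n => ℂ)) : ‖v‖ ≤ ∑ i, ‖v i‖ := by
  have h : v = ∑ i, PiLp.single p (β := fun _ : Fin n => ℂ) i (v i) := by
    ext j
    simp [WithLp.ofLp_sum, Finset.sum_apply, Pi.single_apply]
  calc ‖v‖ = ‖∑ i, PiLp.single p (β := fun _ : Fin n => ℂ) i (v i)‖ := congrArg norm h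
    _ ≤ ∑ i, ‖PiLp.single p (β := fun _ : Fin n => ℂ) i (v i)‖ := norm_sum_le _ _
    _ = ∑ i, ‖v i‖ := Finset.sum_congr rfl fun i _ =>
        PiLp.norm_single p (fun _ : Fin n => ℂ) i (v i)

/-- The `ℓ_p` norm is at most the `ℓ₁` norm, which Cauchy-Schwarz and Bessel bound by `‖x‖ ‖y‖`. -/
theorem schattenNorm_le_of_rankOne {A : H →L[ℂ] H} (hA : IsCompactOperator A) {x y : H}
    (h : ∀ η, A η = inner ℂ x η • y) : schattenNorm p A ≤ ENNReal.ofReal (‖x‖ * ‖y‖) := by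
  refine schattenNorm_le_of_pairingVec_le hA fun n e f he hf => ?_
  rw [← ofReal_norm]
  refine ENNReal.ofReal_le_ofReal ((norm_piLp_le_sum _).trans ?_)
  have h1 : ∀ i, ‖pairingVec p e f A i‖ = ‖inner ℂ (e i) x‖ * ‖inner ℂ (f i) y‖ := fun i => by
    simp only [pairingVec]
    rw [h, inner_smul_right, norm_mul, norm_inner_symm]
  simp_rw [h1]
  refine abs_le_of_sq_le_sq' ?_ (by positivity) |>.2
  calc (∑ i, ‖inner ℂ (e i) x‖ * ‖inner ℂ (f i) y‖) ^ 2
      ≤ (∑ i, ‖inner ℂ (e i) x‖ ^ 2) * ∑ i, ‖inner ℂ (f i) y‖ ^ 2 :=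
        Finset.sum_mul_sq_le_sq_mul_sq _ _ _
    _ ≤ ‖x‖ ^ 2 * ‖y‖ ^ 2 := by
        gcongr
        · exact he.sum_inner_products_le x
        · exact hf.sum_inner_products_le y
    _ = _ := by ring

theorem enorm_inner_le_schattenNorm {A : H →L[ℂ] H} (hA : IsCompactOperator A) (x y : H) :
    ‖inner ℂ y (A x)‖ₑ ≤ ENNReal.ofReal (‖x‖ * ‖y‖) * schattenNorm p A := by
  rcases eq_or_ne x 0 with rfl | hx
  · simp
  rcases eq_or_ne y 0 with rfl | hy
  · simp
  have hON : ∀ z : H, z ≠ 0 → Orthonormal ℂ (fun _ : Fin 1 => ((‖z‖ : ℂ)⁻¹) • z) := fun z hz =>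
    ⟨fun _ => by simp [norm_smul, inv_mul_cancel₀ (norm_ne_zero_iff.2 hz)],
      fun i j hij => absurd (Subsingleton.elim i j) hij⟩
  have h1 := enorm_pairingVec_le (p := p) hA (hON x hx) (hON y hy)
  have h2 : inner ℂ y (A x) = ((‖x‖ * ‖y‖ : ℝ) : ℂ) *
      pairingVec p (fun _ : Fin 1 => ((‖x‖ : ℂ)⁻¹) • x) (fun _ => ((‖y‖ : ℂ)⁻¹) • y) A 0 := by
    have hx' : (‖x‖ : ℂ) ≠ 0 := by simpa using hx
    have hy' : (‖y‖ : ℂ) ≠ 0 := by simpa using hy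
    simp only [pairingVec, map_smul, inner_smul_left, inner_smul_right, map_inv₀,
      Complex.conj_ofReal, Complex.ofReal_mul]
    field_simp
  rw [h2, enorm_mul]
  gcongr
  · rw [← ofReal_norm, Complex.norm_real, Real.norm_of_nonneg (by positivity)]
  · refine le_trans ?_ h1
    rw [enorm_le_iff_norm_le]
    exact PiLp.norm_apply_le _ 0

end RankOne

/-! ### Testing a symbol on indicator kernels -/

section IndicatorKernel

variable {X : Type*} [MeasurableSpace X] {ν : Measure X} {p : ℝ≥0∞} [Fact (1 ≤ p)]

theorem norm_le_of_norm_coeFn_le {k k' : HSKernel ν}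
    (h : ∀ᵐ g ∂ν, ∀ᵐ h ∂ν, ‖k' g h‖ ≤ ‖k g h‖) : ‖k'‖ ≤ ‖k‖ :=
  Lp.norm_le_norm_of_ae_le (h.mono fun _ hg => Lp.norm_le_norm_of_ae_le hg)

/-- The rank one kernel `1_U ⊗ 1_U`. -/
def indicatorKernel {U : Set X} (hU : MeasurableSet U) (hν : ν U ≠ ∞) : HSKernel ν :=
  indicatorConstLp 2 hU hν (indicatorConstLp 2 hU hν (1 : ℂ))

variable {U : Set X} (hU : MeasurableSet U) (hν : ν U ≠ ∞)

theorem star_indicatorConstLp_one :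
    star (indicatorConstLp 2 hU hν (1 : ℂ)) = indicatorConstLp 2 hU hν (1 : ℂ) := by
  refine Lp.ext ?_
  filter_upwards [Lp.coeFn_star (indicatorConstLp 2 hU hν (1 : ℂ)),
    indicatorConstLp_coeFn (p := 2) (hs := hU) (hμs := hν) (c := (1 : ℂ))] with x h1 h2
  rw [h1, Pi.star_apply, h2]
  by_cases hx : x ∈ U <;> simp [hx]

theorem kernelOp_indicatorKernel (η : Lp ℂ 2 ν) :
    kernelOp (indicatorKernel hU hν) η =
      (inner ℂ (indicatorConstLp 2 hU hν (1 : ℂ)) η : ℂ) • indicatorConstLp 2 hU hν (1 : ℂ) := by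
  rw [indicatorKernel, kernelOp_indicatorConstLp, pairing_comm, pairing_comm, pairing,
    star_indicatorConstLp_one]
  rfl

theorem norm_indicatorKernel :
    ‖indicatorKernel hU hν‖ = ‖indicatorConstLp 2 hU hν (1 : ℂ)‖ ^ 2 := by
  rw [indicatorKernel, norm_indicatorConstLp (by norm_num) (by norm_num),
    norm_indicatorConstLp (by norm_num) (by norm_num), norm_one, one_mul, pow_two]

theorem norm_toLp_const_fin_one {H : Type*} [NormedAddCommGroup H] (v : H) :
    ‖(WithLp.toLp 2 fun _ : Fin 1 => v)‖ = ‖v‖ := by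
  rw [PiLp.norm_eq_of_L2]
  simp

theorem matrixSchattenNorm_indicatorKernel_le :
    matrixSchattenNorm p (fun _ _ : Fin 1 => indicatorKernel hU hν) ≤
      ENNReal.ofReal (‖indicatorConstLp 2 hU hν (1 : ℂ)‖ ^ 2) := by
  refine (schattenNorm_le_of_rankOne (isCompactOperator_blockOp_kernelOp _)
    (x := WithLp.toLp 2 fun _ : Fin 1 => indicatorConstLp 2 hU hν (1 : ℂ))
    (y := WithLp.toLp 2 fun _ : Fin 1 => indicatorConstLp 2 hU hν (1 : ℂ)) fun η => ?_).trans ?_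
  · ext i : 1
    rw [blockOp_apply, PiLp.inner_apply]
    simp only [Finset.univ_unique, Finset.sum_singleton]
    exact kernelOp_indicatorKernel hU hν _
  · rw [norm_toLp_const_fin_one, pow_two]

theorem enorm_inner_kernelOp_le (k : HSKernel ν) (x y : Lp ℂ 2 ν) :
    ‖inner ℂ y (kernelOp k x)‖ₑ ≤
      ENNReal.ofReal (‖x‖ * ‖y‖) * matrixSchattenNorm p (fun _ _ : Fin 1 => k) := by
  have h := enorm_inner_le_schattenNorm (p := p)
    (isCompactOperator_blockOp_kernelOp (fun _ _ : Fin 1 => k))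
    (WithLp.toLp 2 fun _ => x) (WithLp.toLp 2 fun _ => y)
  rw [inner_blockOp, norm_toLp_const_fin_one, norm_toLp_const_fin_one] at h
  simp only [Finset.univ_unique, Finset.sum_singleton] at h
  exact h

/-- On `1_U ⊗ 1_U` the multiplier differs from the scalar `c` by a kernel of Hilbert-Schmidt norm at
most `ν U`. Comparing coefficients at `1_U` bounds `c` by the multiplier bound plus one. -/
theorem enorm_le_of_isSchurProduct_indicatorKernel (h0 : ν U ≠ 0) {s : X → X → ℂ} {k : HSKernel ν}
    (hk : IsSchurProduct s (indicatorKernel hU hν) k) {c : ℂ}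
    (hs : ∀ g ∈ U, ∀ h, ‖s g h - c‖ ≤ 1) {C : ℝ≥0∞}
    (hC : matrixSchattenNorm p (fun _ _ : Fin 1 => k) ≤
      C * matrixSchattenNorm p (fun _ _ : Fin 1 => indicatorKernel hU hν)) : ‖c‖ₑ ≤ C + 1 := by
  set v : Lp ℂ 2 ν := indicatorConstLp 2 hU hν (1 : ℂ) with hv
  have hv0 : 0 < ‖v‖ := by
    rw [hv, norm_indicatorConstLp (by norm_num) (by norm_num), norm_one, one_mul]
    exact Real.rpow_pos_of_pos (ENNReal.toReal_pos h0 hν) _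
  have hd : ‖c • indicatorKernel hU hν - k‖ ≤ ‖indicatorKernel hU hν‖ := by
    refine norm_le_of_norm_coeFn_le ?_
    filter_upwards [hk, Lp.coeFn_sub (c • indicatorKernel hU hν) k,
      Lp.coeFn_smul c (indicatorKernel hU hν), indicatorConstLp_coeFn (p := 2) (hs := hU)
        (hμs := hν) (c := v)] with g h1 h2 h3 h4
    rw [h2, Pi.sub_apply, h3, Pi.smul_apply]
    filter_upwards [h1, Lp.coeFn_sub (c • indicatorKernel hU hν g) (k g),
      Lp.coeFn_smul c (indicatorKernel hU hν g), Lp.coeFn_zero ℂ 2 ν] with h h5 h6 h7 h8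
    rw [h6, Pi.sub_apply, h7, Pi.smul_apply, h5, smul_eq_mul, ← sub_mul, norm_mul]
    by_cases hg : g ∈ U
    · rw [norm_sub_rev]
      exact mul_le_of_le_one_left (norm_nonneg _) (hs g hg h)
    · have : indicatorKernel hU hν g = 0 := h4.trans (Set.indicator_of_notMem hg _)
      rw [this, h8]
      simp
  have h1 : c * ((‖v‖ ^ 4 : ℝ) : ℂ) = inner ℂ v (kernelOp k v) +
      inner ℂ v (kernelOp (c • indicatorKernel hU hν - k) v) := by
    have e1 : kernelOp (c • indicatorKernel hU hν - k) v =
        c • kernelOp (indicatorKernel hU hν) v - kernelOp k v := by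
      rw [← kernelOpL_apply, map_sub, map_smul]; rfl
    rw [e1, inner_sub_right, inner_smul_right, kernelOp_indicatorKernel, inner_smul_right,
      inner_self_eq_norm_sq_to_K, ← hv]
    push_cast
    simp only [Complex.coe_algebraMap]
    ring
  have h2 : ‖inner ℂ v (kernelOp (c • indicatorKernel hU hν - k) v)‖ₑ ≤
      ENNReal.ofReal (‖v‖ ^ 4) := by
    rw [← ofReal_norm]
    refine ENNReal.ofReal_le_ofReal ((norm_inner_le_norm _ _).trans ?_)
    calc ‖v‖ * ‖kernelOp (c • indicatorKernel hU hν - k) v‖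
        ≤ ‖v‖ * (‖v‖ ^ 2 * ‖v‖) := by
          gcongr
          refine (ContinuousLinearMap.le_opNorm _ _).trans ?_
          gcongr
          exact (norm_kernelOp_le _).trans (hd.trans (norm_indicatorKernel hU hν).le)
      _ = _ := by ring
  have h3 : ‖inner ℂ v (kernelOp k v)‖ₑ ≤ C * ENNReal.ofReal (‖v‖ ^ 4) :=
    calc _ ≤ ENNReal.ofReal (‖v‖ * ‖v‖) * (C * ENNReal.ofReal (‖v‖ ^ 2)) :=
          (enorm_inner_kernelOp_le k v v).trans
            (mul_le_mul' le_rfl (hC.trans (mul_le_mul' le_rfl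
              (matrixSchattenNorm_indicatorKernel_le hU hν))))
      _ = C * (ENNReal.ofReal (‖v‖ * ‖v‖) * ENNReal.ofReal (‖v‖ ^ 2)) := by ring
      _ = _ := by
          rw [← ENNReal.ofReal_mul (by positivity)]
          congr 2
          ring
  have h4 : ENNReal.ofReal (‖v‖ ^ 4) ≠ 0 := by simpa using hv0.ne'
  rw [← ENNReal.mul_le_mul_iff_left h4 ENNReal.ofReal_ne_top, add_mul, one_mul]
  calc ‖c‖ₑ * ENNReal.ofReal (‖v‖ ^ 4) = ‖c * ((‖v‖ ^ 4 : ℝ) : ℂ)‖ₑ := by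
        rw [enorm_mul]
        congr 1
        rw [← ofReal_norm, Complex.norm_real, Real.norm_of_nonneg (by positivity)]
    _ ≤ _ := by
        rw [h1]
        exact (enorm_add_le _ _).trans (add_le_add h3 h2)

end IndicatorKernel

/-- Radial truncation of the values at radius `R`. -/
theorem exists_bcf_eq_of_norm_le {Y : Type*} [TopologicalSpace Y] (F : C(Y, ℂ)) {R : ℝ}
    (hR : 0 < R) : ∃ M : Y →ᵇ ℂ, ∀ y, ‖F y‖ ≤ R → M y = F y := by
  have hpos : ∀ y, 0 < max R ‖F y‖ := fun y => lt_max_of_lt_left hR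
  refine ⟨ofNormedAddCommGroup (fun y => ((R / max R ‖F y‖ : ℝ) : ℂ) * F y) ?_ R (fun y => ?_),
    fun y hy => ?_⟩
  · exact (Complex.continuous_ofReal.comp (continuous_const.div
      (continuous_const.max F.continuous.norm) fun y => (hpos y).ne')).mul F.continuous
  · rw [norm_mul, Complex.norm_real, Real.norm_of_nonneg (div_nonneg hR.le (hpos y).le),
      div_mul_eq_mul_div, div_le_iff₀ (hpos y)]
    exact mul_le_mul_of_nonneg_left (le_max_right _ _) hR.le
  · change ((R / max R ‖F y‖ : ℝ) : ℂ) * F y = F y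
    rw [max_eq_left hy, div_self hR.ne', Complex.ofReal_one, one_mul]

/-! ### Deducing boundedness of the symbol -/

section Unbounded

variable {X : Type*} [MeasurableSpace X] {ν : Measure X} {d : ℕ}
  {S T : Type*} [TopologicalSpace S] [TopologicalSpace T]
  {P : X → S} {Q : X → T} [SecondCountableTopology S] [TopologicalSpace.PseudoMetrizableSpace S]
  [MeasurableSpace S] [BorelSpace S]
  {p : ℝ≥0∞} [Fact (1 ≤ p)] {n : ℕ}

theorem matrixLpNorm_twist_ne_top [MeasurableSpace T] [BorelSpace T]
    (hP : Measurable P) (hQ : Measurable Q)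
    (b₁ : C(S, EuclideanSpace ℝ (Fin d))) (b₂ : C(T, EuclideanSpace ℝ (Fin d)))
    (φ : 𝓢(EuclideanSpace ℝ (Fin d), ℂ))
    {a : Matrix (Fin n) (Fin n) (HSKernel ν)} (ha : matrixSchattenNorm p a ≠ ∞) :
    matrixLpNorm p (a.map (twist hP hQ (sumMap b₁ b₂) φ)) ≠ ∞ :=
  ((matrixLpNorm_twist_le hP hQ b₁ b₂ φ ha).trans_lt
    (ENNReal.mul_lt_top (φ.memLp p volume).eLpNorm_lt_top ha.lt_top)).ne

/-- With the constant shift `ξ₀`, the lift of `1_U ⊗ 1_U` is carried by rows in `U` and frequencies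
in the `δ`-ball about `ξ₀`, so the symbol is irrelevant elsewhere and may be truncated. -/
theorem isTwistedMultiplierImage_of_locally_eq (hP : Measurable P)
    {F M : EuclideanSpace ℝ (Fin d) × S → ℂ}
    {U : Set X} (hU : MeasurableSet U) (hν : ν U ≠ ∞) {ξ₀ : EuclideanSpace ℝ (Fin d)} {δ : ℝ}
    (hM : ∀ g ∈ U, ∀ ξ ∈ Metric.ball ξ₀ δ, M (ξ, P g) = F (ξ, P g))
    {φ : 𝓢(EuclideanSpace ℝ (Fin d), ℂ)} (hφ : ∀ ξ, δ ≤ ‖ξ‖ → 𝓕 φ ξ = 0) {y : L2HS ν d}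
    (hy : IsTwistedMultiplierImage (fun g ξ => F (ξ, P g))
      (twist hP hP (sumMap (ContinuousMap.const S ξ₀) (ContinuousMap.const S 0)) φ
        (indicatorKernel hU hν)) y) :
    IsTwistedMultiplierImage (fun g ξ => M (ξ, P g))
      (twist hP hP (sumMap (ContinuousMap.const S ξ₀) (ContinuousMap.const S 0)) φ
        (indicatorKernel hU hν)) y := by
  filter_upwards [hy, fourier_twist hP hP
    (sumMap (ContinuousMap.const S ξ₀) (ContinuousMap.const S 0)) φ (indicatorKernel hU hν)]
    with ξ h1 h2
  rw [h2] at h1 ⊢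
  filter_upwards [h1, isSchurProduct_schurMul hP hP (shiftBCF (sumMap (ContinuousMap.const S ξ₀)
    (ContinuousMap.const S 0)) (𝓕 φ) ξ) (indicatorKernel hU hν),
    indicatorConstLp_coeFn (p := 2) (hs := hU) (hμs := hν)
      (c := indicatorConstLp 2 hU hν (1 : ℂ))] with g h3 h4 h5
  filter_upwards [h3, h4, Lp.coeFn_zero ℂ 2 ν] with h h6 h7 h8
  rw [h6]
  by_cases hg : g ∈ U
  · by_cases hξ : ξ ∈ Metric.ball ξ₀ δ
    · rw [hM g hg ξ hξ]
    · rw [h7, shiftBCF_apply, hφ, zero_mul, mul_zero, mul_zero]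
      simpa [sumMap, dist_eq_norm] using hξ
  · have : indicatorKernel hU hν g = 0 := h5.trans (Set.indicator_of_notMem hg _)
    rw [h7, this, h8, Pi.zero_apply, mul_zero, mul_zero, mul_zero]

/-- Transference localised at a frequency `ξ₀` and a set `U` of rows. What matters is that `K` does
not depend on `U`, `ξ₀`, `δ` or `c`; its size plays no role in the final constant. -/
theorem exists_enorm_bound_of_twisted (hP : Measurable P)
    (F : C(EuclideanSpace ℝ (Fin d) × S, ℂ)) {C : ℝ≥0∞}
    (hC : C ≠ ∞)
    (hT : ∀ x : Matrix (Fin 1) (Fin 1) (L2HS ν d), matrixLpNorm p x ≠ ∞ →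
      ∃ y : Matrix (Fin 1) (Fin 1) (L2HS ν d),
        (∀ i j, IsTwistedMultiplierImage (fun g ξ => F (ξ, P g)) (x i j) (y i j)) ∧
        matrixLpNorm p y ≤ C * matrixLpNorm p x) :
    ∃ K : ℝ≥0∞, K ≠ ∞ ∧ ∀ (U : Set X), MeasurableSet U → ν U ≠ 0 → ν U ≠ ∞ →
      ∀ (ξ₀ : EuclideanSpace ℝ (Fin d)) (δ : ℝ) (c : ℂ), 0 < δ →
        (∀ g ∈ U, ∀ ξ ∈ Metric.ball ξ₀ δ, ‖F (ξ, P g) - c‖ ≤ 1) → ‖c‖ₑ ≤ K := by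
  have := (ENNReal.HolderConjugate.inv_one_sub_inv' (Fact.out : 1 ≤ p)).symm
  obtain ⟨u, hu⟩ := exists_units_tendsto_zero
  -- The bump is placed on the Fourier side: the transform of `dil (u m) φ` vanishes for `‖ξ‖ ≥ 2 |u
  -- m|`, hence outside the `δ`-ball once `2 |u m| < δ`.
  let f : ContDiffBump (0 : EuclideanSpace ℝ (Fin d)) := ⟨1, 2, one_pos, one_lt_two⟩
  let φ : 𝓢(EuclideanSpace ℝ (Fin d), ℂ) := 𝓕⁻ (bumpSchwartz f)
  have hφ : 𝓕 φ = bumpSchwartz f := FourierTransform.fourier_fourierInv_eq _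
  set I := ENNReal.ofReal (∫ x, ‖φ x‖ ^ 2) with hI
  have hI0 : I ≠ 0 := by
    rw [hI, ← integral_norm_sq_fourier, hφ]
    exact ((Metric.measure_ball_pos volume (0 : EuclideanSpace ℝ (Fin d)) f.rIn_pos).trans_le
      (volume_ball_le_integral_norm_sq_bumpSchwartz f)).ne'
  set K := C * (eLpNorm φ p volume * eLpNorm φ (1 - p⁻¹)⁻¹ volume) / I with hK
  refine ⟨K + 1, ENNReal.add_ne_top.2 ⟨ENNReal.div_ne_top (ENNReal.mul_ne_top hC
    (ENNReal.mul_ne_top (φ.memLp _ volume).eLpNorm_ne_top (φ.memLp _ volume).eLpNorm_ne_top)) hI0,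
    ENNReal.one_ne_top⟩, fun U hU h0 hν ξ₀ δ c hδ hF => ?_⟩
  -- On `U` and the ball the symbol is within `1` of `c`, so this truncation does not alter it
  -- there.
  obtain ⟨M, hM⟩ := exists_bcf_eq_of_norm_le F (R := ‖c‖ + 1) (by positivity)
  have hMF : ∀ g ∈ U, ∀ ξ ∈ Metric.ball ξ₀ δ, M (ξ, P g) = F (ξ, P g) := fun g hg ξ hξ =>
    hM _ (by linarith [norm_le_norm_add_norm_sub' (F (ξ, P g)) c, hF g hg ξ hξ])
  have ha : matrixSchattenNorm p (fun _ _ : Fin 1 => indicatorKernel hU hν) ≠ ∞ :=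
    ((matrixSchattenNorm_indicatorKernel_le hU hν).trans_lt ENNReal.ofReal_lt_top).ne
  have hev : ∀ᶠ m in atTop, 2 * |(u m : ℝ)| < δ := by
    have := (hu.abs.const_mul 2)
    rw [abs_zero, mul_zero] at this
    exact this.eventually_lt_const hδ
  have h1 := matrixSchattenNorm_schurMul_transBCF_le (q := (1 - p⁻¹)⁻¹) (C := C) hP hP
    (ContinuousMap.const S ξ₀) (ContinuousMap.const S 0) φ M ha hu (hev.mono fun m hm => by
      obtain ⟨y, hy, hyC⟩ := hT _ (matrixLpNorm_twist_ne_top hP hP (ContinuousMap.const S ξ₀)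
        (ContinuousMap.const S 0) (dil (u m) φ) ha)
      refine ⟨y, fun i j => isTwistedMultiplierImage_of_locally_eq hP hU hν hMF (fun ξ hξ => ?_)
        (hy i j), hyC⟩
      rw [fourier_dil, hφ, bumpSchwartz_apply, f.zero_of_le_dist, Complex.ofReal_zero, smul_zero]
      rw [dist_zero_right, norm_smul, norm_inv, Real.norm_eq_abs, inv_mul_eq_div,
        le_div_iff₀ (abs_pos.2 (u m).ne_zero)]
      exact hm.le.trans hξ)
  refine enorm_le_of_isSchurProduct_indicatorKernel hU hν h0 (p := p)
    (isSchurProduct_schurMul hP hP (transBCF (sumMap (ContinuousMap.const S ξ₀)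
      (ContinuousMap.const S 0)) M 0) (indicatorKernel hU hν)) (fun g hg h => ?_) ?_
  · have hξ : ξ₀ ∈ Metric.ball ξ₀ δ := Metric.mem_ball_self hδ
    rw [transBCF_apply]
    simp only [sumMap, ContinuousMap.coe_mk, ContinuousMap.const_apply, add_zero, zero_add]
    rw [hMF g hg _ hξ]
    exact hF g hg _ hξ
  · rw [hK, ← ENNReal.mul_div_right_comm,
      ENNReal.le_div_iff_mul_le (Or.inl hI0) (Or.inl ENNReal.ofReal_ne_top), mul_comm _ I]
    exact h1

variable [MeasurableSpace T] [BorelSpace T] [FirstCountableTopology T]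

/-- Almost every row of the symbol is bounded by `K`, so truncation changes neither multiplier and
the bounded case applies. -/
theorem exists_isSchurProduct_of_twisted (hP : Measurable P) (hQ : Measurable Q)
    (F : C(EuclideanSpace ℝ (Fin d) × S, ℂ))
    (b₁ : C(S, EuclideanSpace ℝ (Fin d))) (b₂ : C(T, EuclideanSpace ℝ (Fin d)))
    {s : X → X → ℂ} (hs : ∀ g h, s g h = F (b₁ (P g) + b₂ (Q h), P g)) {K : ℝ}
    (hK : ∀ᵐ g ∂ν, ∀ ξ, ‖F (ξ, P g)‖ ≤ K) {C : ℝ≥0∞} (hC : C ≠ ∞)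
    {a : Matrix (Fin n) (Fin n) (HSKernel ν)} (ha : matrixSchattenNorm p a ≠ ∞)
    (hT : ∀ x : Matrix (Fin n) (Fin n) (L2HS ν d), matrixLpNorm p x ≠ ∞ →
      ∃ y : Matrix (Fin n) (Fin n) (L2HS ν d),
        (∀ i j, IsTwistedMultiplierImage (fun g ξ => F (ξ, P g)) (x i j) (y i j)) ∧
        matrixLpNorm p y ≤ C * matrixLpNorm p x) :
    ∃ k : Matrix (Fin n) (Fin n) (HSKernel ν), (∀ i j, IsSchurProduct s (a i j) (k i j)) ∧
      matrixSchattenNorm p k ≤ C * matrixSchattenNorm p a := by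
  obtain ⟨M, hM⟩ := exists_bcf_eq_of_norm_le F (R := max K 1) (by positivity)
  have hM' : ∀ᵐ g ∂ν, ∀ ξ, M (ξ, P g) = F (ξ, P g) :=
    hK.mono fun g hg ξ => hM _ ((hg ξ).trans (le_max_left _ _))
  refine ⟨a.map (schurMul hP hQ (transBCF (sumMap b₁ b₂) M 0)), fun i j => ?_,
    matrixSchattenNorm_transBCF_le_of_twisted hP hQ b₁ b₂ M hC ha fun φ => ?_⟩
  · filter_upwards [hM', isSchurProduct_schurMul hP hQ (transBCF (sumMap b₁ b₂) M 0) (a i j)]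
      with g h1 h2
    filter_upwards [h2] with h h3
    rw [Matrix.map_apply, h3, transBCF_apply, h1, hs, zero_add]
    rfl
  · obtain ⟨y, hy, hyC⟩ := hT _ (matrixLpNorm_twist_ne_top hP hQ b₁ b₂ φ ha)
    refine ⟨y, fun i j => ?_, hyC⟩
    filter_upwards [hy i j] with ξ hξ
    filter_upwards [hM', hξ] with g h1 h2
    filter_upwards [h2] with h h3
    rw [h1, h3]
    rfl

end Unbounded

/-! ### The cocycle identity -/

section Cocycle

variable {d : ℕ}

theorem slAct_sub (A : Matrix.SpecialLinearGroup (Fin d) ℝ) (ξ η : EuclideanSpace ℝ (Fin d)) :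
    slAct A (ξ - η) = slAct A ξ - slAct A η := by
  rw [slAct, slAct, slAct, WithLp.ofLp_sub, Matrix.mulVec_sub, WithLp.toLp_sub]

theorem slAct_one (ξ : EuclideanSpace ℝ (Fin d)) : slAct 1 ξ = ξ := by
  simp [slAct]

/-- By linearity and the cocycle law, the left side is `(β (g * h⁻¹) - β g) - (β 1 - β g)`, and `β 1
= 0`. This is the link between the Schur symbol and the twisted one. -/
theorem slAct_cocycle {G : Type*} [Group G] {α : G →* Matrix.SpecialLinearGroup (Fin d) ℝ}
    {β : G → EuclideanSpace ℝ (Fin d)}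
    (hβ : ∀ g h : G, slAct (α g) (β h) = β (g * h) - β g) (g h : G) :
    slAct (α g) (-β g⁻¹ + β h⁻¹) = β (g * h⁻¹) := by
  have h1 : β 1 = 0 := by
    have := hβ 1 1
    rwa [map_one, slAct_one, mul_one, sub_self] at this
  rw [neg_add_eq_sub, slAct_sub, hβ, hβ, mul_inv_cancel, h1]
  abel

end Cocycle

end TwistedMultiplier

end

/-! ### Conclusion -/

theorem mainTheorem10 {G : Type*} [Group G] [TopologicalSpace G] [IsTopologicalGroup G]
    [LocallyCompactSpace G] [T2Space G] [MeasurableSpace G] [BorelSpace G]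
    (μ : Measure G) [μ.IsHaarMeasure] [μ.IsMulRightInvariant]
    (S : Set G) (hS : IsOpen S) (d : ℕ)
    (α : G →* Matrix.SpecialLinearGroup (Fin d) ℝ) (hα : Continuous α)
    (β : G → EuclideanSpace ℝ (Fin d)) (hβ : Continuous β)
    (hcocycle : ∀ g h : G, TwistedMultiplier.slAct (α g) (β h) = β (g * h) - β g)
    (p : ℝ≥0∞) (hp : 1 ≤ p)
    (mdot : EuclideanSpace ℝ (Fin d) → ℂ) (hmdot : Continuous mdot)
    (m : G → ℂ) (hm : m = mdot ∘ β) :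
    TwistedMultiplier.schurCbNorm (μ.restrict S) p m ≤
      TwistedMultiplier.twistedCbNorm (μ.restrict S) p
        (fun g ξ => mdot (TwistedMultiplier.slAct (α g) ξ)) := by
  have : Fact (1 ≤ p) := ⟨hp⟩
  refine le_sInf fun C hT => ?_
  rcases eq_or_ne C ∞ with rfl | hC
  · exact le_top
  refine sInf_le fun n a ha => ?_
  -- The row data are recorded in a finite-dimensional space: the entries of `α g` determine the
  -- multiplier and `β g⁻¹` the shift. This supplies the second countability that `G` may lack.
  let P : G → (Fin d → Fin d → ℝ) × EuclideanSpace ℝ (Fin d) :=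
    fun g => (fun i j => (α g).1 i j, β g⁻¹)
  have hPc : Continuous P := by
    refine Continuous.prodMk (continuous_pi fun i => continuous_pi fun j => ?_) (by fun_prop)
    exact (continuous_subtype_val.comp hα).matrix_elem i j
  let F : C(EuclideanSpace ℝ (Fin d) × ((Fin d → Fin d → ℝ) × EuclideanSpace ℝ (Fin d)), ℂ) :=
    ⟨fun z => mdot (WithLp.toLp 2 (Matrix.mulVec (Matrix.of z.2.1) z.1.ofLp)), by
      refine hmdot.comp ((PiLp.continuous_toLp 2 _).comp (Continuous.matrix_mulVec ?_ ?_))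
      · exact continuous_snd.fst
      · fun_prop⟩
  have hF : ∀ g ξ, F (ξ, P g) = mdot (TwistedMultiplier.slAct (α g) ξ) := fun g ξ => rfl
  -- The scalar level `n = 1` of the hypothesis already bounds the symbol.
  obtain ⟨K, hK, hKb⟩ := TwistedMultiplier.exists_enorm_bound_of_twisted (p := p) (ν := μ.restrict S)
    hPc.measurable F hC (hT 1)
  have hbound : ∀ g ∈ S, ∀ ξ, ‖F (ξ, P g)‖ ≤ K.toReal := fun g hg ξ => by
    have hcont : Continuous fun z : EuclideanSpace ℝ (Fin d) × G => F (z.1, P z.2) :=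
      F.continuous.comp (by fun_prop)
    have hnear := (Metric.continuousAt_iff'.1 (hcont.continuousAt (x := (ξ, g)))) 1 one_pos
    rw [nhds_prod_eq] at hnear
    obtain ⟨pa, ha', pb, hb', hab⟩ := Filter.eventually_prod_iff.1 hnear
    obtain ⟨δ, hδ, hδa⟩ := Metric.eventually_nhds_iff_ball.1 ha'
    obtain ⟨V, hVb, hVo, hgV⟩ := eventually_nhds_iff.1 hb'
    obtain ⟨W, hgW, hWo, hWμ⟩ := μ.exists_isOpen_measure_lt_top g
    -- Openness of `S` gives this neighbourhood of `g` positive Haar measure; `W` makes it finite,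
    -- and on `V` the symbol varies by less than `1`.
    have hUo : IsOpen (V ∩ W ∩ S) := (hVo.inter hWo).inter hS
    have hUν : μ.restrict S (V ∩ W ∩ S) = μ (V ∩ W ∩ S) := by
      rw [Measure.restrict_apply hUo.measurableSet, Set.inter_assoc, Set.inter_self]
    have h := hKb (V ∩ W ∩ S) hUo.measurableSet
      (by rw [hUν]; exact (hUo.measure_pos μ ⟨g, ⟨hgV, hgW⟩, hg⟩).ne')
      (by rw [hUν]; exact ((measure_mono fun x hx => hx.1.2).trans_lt hWμ).ne)
      ξ δ (F (ξ, P g)) hδ fun g' hg' ξ' hξ' => by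
        have := hab (hδa ξ' hξ') (hVb g' hg'.1.1)
        rw [← dist_eq_norm]
        exact this.le
    rw [← toReal_enorm]
    exact ENNReal.toReal_mono hK h
  refine TwistedMultiplier.exists_isSchurProduct_of_twisted (T := EuclideanSpace ℝ (Fin d)) hPc.measurable
    (Q := fun h => β h⁻¹) (by fun_prop : Continuous fun h : G => β h⁻¹).measurable F
    ⟨fun s => -s.2, by fun_prop⟩ (ContinuousMap.id _) (fun g h => ?_)
    ((ae_restrict_mem hS.measurableSet).mono hbound) hC ha (hT n)
  rw [hF, hm]
  exact congrArg mdot (TwistedMultiplier.slAct_cocycle hcocycle g h).symm
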